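/- Let $\Omega\subset\mathbb{R}^2$ be a bounded strictly convex domain with $C^\infty$ boundary of perimeter $\ell>0$, and let $\xi:\mathbb{R}\to\partial\Omega$ be an $\ell$-periodic arc-length parametrization of the boundary, injective on $[0,\ell)$. For integers $q\ge 2$ and $p$ in lowest terms with $0<p/q\le 1/2$ put \[ \beta(p/q)=\frac1q\min\Big\{-\sum_{i=0}^{q-1}\|\xi(x_i)-\xi(x_{i+1})\| \;:\; x_i\le x_{i+1}\le x_i+\ell\ (0\le i<q),\ x_q=x_0+p\ell\Big\}, \] so that $-q\beta(p/q)$ is the maximal perimeter of inscribed $q$-gons that wind $p$ times around $\partial\Omega$. For irrational $\omega\in(0,1/2)$ put $\beta(\omega)=\lim_{p/q\to\omega}\beta(p/q)$; these limits exist. This is Mather's $\beta$-function $\beta:(0,1/2]\to\mathbb{R}$ of the billiard in $\Omega$. Then there are unique real numbers $\beta_1,\beta_3$ such that \[ \beta(h)=\beta_1h+\frac{\beta_3}{3!}h^3+o(h^3)\qquad(h\to0^+), \] and they satisfy \[ \beta_3+\pi^2\beta_1\le 0 . \] Equality holds if and only if $\Omega$ is a disc. -/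

import Mathlib

open Set Filter Topology Asymptotics
open scoped ContDiff Nat

noncomputable section

namespace Billiard

/-- The Euclidean plane. -/
abbrev Plane : Type := EuclideanSpace ℝ (Fin 2)

/-- A bounded strictly convex planar domain: a nonempty bounded open convex set such that the open
segment between two distinct points of its closure lies in the interior, that is, such that the
boundary contains no segment. -/
structure IsStrictlyConvexDomain (Ω : Set Plane) : Prop where
  isOpen : IsOpen Ω
  nonempty : Ω.Nonempty
  isBounded : Bornology.IsBounded Ω
  convex : Convex ℝ Ω
  strictConvex : StrictConvex ℝ (closure Ω)

/-- `ξ` is a smooth arc-length parametrization of the boundary of `Ω`, of perimeter `ℓ`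
(extended to an `ℓ`-periodic map on the universal cover `ℝ` of the boundary). -/
structure IsArcLengthBoundary (Ω : Set Plane) (ℓ : ℝ) (ξ : ℝ → Plane) : Prop where
  pos : 0 < ℓ
  smooth : ContDiff ℝ ∞ ξ
  unitSpeed : ∀ s, ‖deriv ξ s‖ = 1
  periodic : Function.Periodic ξ ℓ
  injOn : InjOn ξ (Ico 0 ℓ)
  range_eq : range ξ = frontier Ω

/-- The generating function of the billiard map on the universal cover:
minus the length of the chord. -/
def gen (ξ : ℝ → Plane) (x y : ℝ) : ℝ := -‖ξ x - ξ y‖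

/-- Configurations `x₀ = s, x₁, …, x_q = s + p ℓ` of winding number `p` and period `q`: every step
moves in the positive direction and by at most one full turn, `x i ≤ x (i + 1) ≤ x i + ℓ`, so that
`p` counts the turns around the boundary. Only the values `x 0, …, x q` matter. -/
structure IsConfiguration (ℓ s : ℝ) (p : ℤ) (q : ℕ) (x : ℕ → ℝ) : Prop where
  start : x 0 = s
  finish : x q = s + p * ℓ
  step : ∀ i < q, x i ≤ x (i + 1) ∧ x (i + 1) ≤ x i + ℓ

/-- The barrier function `𝓑(s, p/q)`, the minimal action of the configurations of type `(p, q)`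
that start at `s`. For `0 ≤ p ≤ q` they exist and their first `q + 1` terms form a compact set, so
the infimum is a minimum. -/
def barrier (ξ : ℝ → Plane) (ℓ s : ℝ) (p : ℤ) (q : ℕ) : ℝ :=
  sInf {A : ℝ | ∃ x : ℕ → ℝ, IsConfiguration ℓ s p q x ∧
    A = ∑ i ∈ Finset.range q, gen ξ (x i) (x (i + 1))}

/-- The values of Mather's β-function at rational rotation numbers `p/q` in lowest terms:
`β(p/q) = (1/q) min_s 𝓑(s, p/q)`. -/
def betaRat (ξ : ℝ → Plane) (ℓ : ℝ) (r : ℚ) : ℝ :=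
  1 / (r.den : ℝ) * sInf ((fun s => barrier ξ ℓ s r.num r.den) '' Icc 0 ℓ)

open Classical in
/-- Mather's β-function (meaningful on `(0, 1/2]`): at rational points it is `betaRat`, and at an
irrational `w` it is the limit of `betaRat r` as the rational number `r` tends to `w`. -/
def beta (ξ : ℝ → Plane) (ℓ : ℝ) (w : ℝ) : ℝ :=
  if h : ∃ r : ℚ, (r : ℝ) = w then betaRat ξ ℓ h.choose
  else limUnder (comap (fun r : ℚ => (r : ℝ)) (𝓝 w)) (betaRat ξ ℓ)

/-- `b 0, …, b N` are the Taylor coefficients of `f` at `0⁺` up to order `N`, normalized as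
derivatives: `f h = ∑_{n ≤ N} (b n / n!) hⁿ + o(h ^ N)` as `h → 0⁺`. They are unique. -/
def HasTaylorCoeffs (f : ℝ → ℝ) (N : ℕ) (b : ℕ → ℝ) : Prop :=
  (fun h : ℝ => f h - ∑ n ∈ Finset.range (N + 1), b n / (n ! : ℝ) * h ^ n)
    =o[𝓝[>] 0] fun h : ℝ => h ^ N

/-- `Ω` is an open disc. -/
def IsDisc (Ω : Set Plane) : Prop := ∃ (c : Plane) (r : ℝ), 0 < r ∧ Ω = Metric.ball c r

end Billiard

end

/-! Let `P n` be the maximal perimeter of inscribed `n`-gons of winding number one, and let `L` be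
the affine length of the boundary, the integral of `κ ^ (2/3)`. The theorem rests on `P n = ℓ - L ^
3 / (24 n ^ 2) + o(n ^ (-2))` together with `L ^ 3 ≤ 4 π ^ 2 ℓ`. The first gives `β₁ = -ℓ` and `β₃ =
L ^ 3 / 4`, so the second is exactly the asserted inequality.

From polygons to `β`: a chain of type `(N p, N q)` can be cut into chains of types `(p, q)` and `((N
- 1) p, (N - 1) q)` without loss of length, because it crosses its own translate and the two
crossing chords can be exchanged (`maxLength_succ_mul_le`). Hence `maxLength` is homogeneous
(`maxLength_mul`) and `-β` depends on the ratio `p / q` alone. Stationary steps and full turns have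
length zero, so on rationals in `(0, 1)` the quotient `-β(r) / r` is nonincreasing and `-β(r) / (1 -
r)` is nondecreasing. Together they make `β` locally Lipschitz on the rationals, whence the limits
at irrationals. The first alone puts `-β(h) / h` between `P n` and `P (n + 1)` for `1 / (n + 1) ≤ h
≤ 1 / n` (`beta_mem_Icc`), which determines the expansion of `β` from that of `P`
(`hasTaylorCoeffs_beta`). Neither convexity of `β` nor existence of maximizing chains is needed.

Asymptotics of `P`: an arc of length `t` exceeds its chord by about `κ ^ 2 t ^ 3 / 24`, the cube of
its affine length over `24` (`exists_chord_defect`). The sum of `n` cubes with given sum is least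
when all are equal, which yields `L ^ 3 / (24 n ^ 2)` (`sub_maxLength_le`, `le_sub_maxLength`).

The inequality is Hölder's, applied with total curvature `2 π` (`integral_curv`,
`affine_isoperimetric`). Equality means constant curvature, that is, a disc (`isDisc_iff`). -/

namespace Billiard

/-! ### Maximal lengths of closed chains -/

/-- The properties of a length function `H x y`, `x ≤ y ≤ x + ℓ`, of the chords of a convex curve
that are used in the variational theory of periodic configurations. -/
structure IsChordLength (ℓ : ℝ) (H : ℝ → ℝ → ℝ) : Prop where
  pos : 0 < ℓ
  nonneg : ∀ x y, 0 ≤ H x y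
  self : ∀ x, H x x = 0
  turn : ∀ x, H x (x + ℓ) = 0
  shift : ∀ x y, H (x + ℓ) (y + ℓ) = H x y
  le_sub : ∀ x y, x ≤ y → H x y ≤ y - x
  quadrangle : ∀ x x' y y', x ≤ x' → x' ≤ y → y ≤ y' → y' ≤ x + ℓ →
    H x y' + H x' y ≤ H x y + H x' y'

/-- Closed chains of winding number `p` and period `q` with an arbitrary starting point. -/
structure IsClosedChain (ℓ : ℝ) (p q : ℕ) (x : ℕ → ℝ) : Prop where
  finish : x q = x 0 + p * ℓ
  step : ∀ i < q, x i ≤ x (i + 1) ∧ x (i + 1) ≤ x i + ℓ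

/-- The total length of the first `q` steps of `x`. -/
def chainLength (H : ℝ → ℝ → ℝ) (q : ℕ) (x : ℕ → ℝ) : ℝ :=
  ∑ i ∈ Finset.range q, H (x i) (x (i + 1))

/-- The maximal length of a closed chain of type `(p, q)`. -/
noncomputable def maxLength (ℓ : ℝ) (H : ℝ → ℝ → ℝ) (p q : ℕ) : ℝ :=
  sSup {A : ℝ | ∃ x, IsClosedChain ℓ p q x ∧ A = chainLength H q x}

section

variable {ℓ : ℝ} {H : ℝ → ℝ → ℝ}

theorem exists_isClosedChain (hℓ : 0 < ℓ) {p q : ℕ} (hpq : p ≤ q) (s : ℝ) :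
    ∃ x, x 0 = s ∧ IsClosedChain ℓ p q x := by
  -- Make `p` full turns, then stay.
  refine ⟨fun i => s + (min i p : ℕ) * ℓ, by simp, ⟨by simp [hpq], fun i _ => ?_⟩⟩
  have h1 : ((min i p : ℕ) : ℝ) ≤ (min (i + 1) p : ℕ) := by
    exact_mod_cast min_le_min_right p (Nat.le_succ i)
  have h2 : ((min (i + 1) p : ℕ) : ℝ) ≤ (min i p : ℕ) + 1 := by
    exact_mod_cast (by omega : min (i + 1) p ≤ min i p + 1)
  constructor
  · nlinarith
  · nlinarith

namespace IsChordLength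

variable (hH : IsChordLength ℓ H)
include hH

theorem shift_nat (n : ℕ) (x y : ℝ) : H (x + n * ℓ) (y + n * ℓ) = H x y := by
  induction n with
  | zero => simp
  | succ n ih =>
    rw [← ih, ← hH.shift (x + n * ℓ)]
    push_cast
    congr 1 <;> ring

theorem shift_int (n : ℤ) (x y : ℝ) : H (x + n * ℓ) (y + n * ℓ) = H x y := by
  obtain ⟨m, rfl | rfl⟩ := n.eq_nat_or_neg
  · exact_mod_cast hH.shift_nat m x y
  · rw [← hH.shift_nat m]
    push_cast
    congr 1 <;> ring

theorem chainLength_le {p q : ℕ} {x : ℕ → ℝ} (hx : IsClosedChain ℓ p q x) :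
    chainLength H q x ≤ p * ℓ := by
  calc chainLength H q x ≤ ∑ i ∈ Finset.range q, (x (i + 1) - x i) :=
        Finset.sum_le_sum fun i hi => hH.le_sub _ _ (hx.step i (Finset.mem_range.1 hi)).1
    _ = p * ℓ := by rw [Finset.sum_range_sub, hx.finish]; ring

theorem bddAbove_chainLength (p q : ℕ) :
    BddAbove {A : ℝ | ∃ x, IsClosedChain ℓ p q x ∧ A = chainLength H q x} := by
  refine ⟨p * ℓ, ?_⟩
  rintro _ ⟨x, hx, rfl⟩
  exact hH.chainLength_le hx

theorem chainLength_le_maxLength {p q : ℕ} {x : ℕ → ℝ} (hx : IsClosedChain ℓ p q x) :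
    chainLength H q x ≤ maxLength ℓ H p q :=
  le_csSup (hH.bddAbove_chainLength p q) ⟨x, hx, rfl⟩

theorem maxLength_le {p q : ℕ} (hpq : p ≤ q) {M : ℝ}
    (h : ∀ x, IsClosedChain ℓ p q x → chainLength H q x ≤ M) : maxLength ℓ H p q ≤ M := by
  refine csSup_le ?_ ?_
  · obtain ⟨x, -, hx⟩ := exists_isClosedChain hH.pos hpq 0
    exact ⟨_, x, hx, rfl⟩
  · rintro _ ⟨x, hx, rfl⟩
    exact h x hx

theorem maxLength_le_mul {p q : ℕ} (hpq : p ≤ q) : maxLength ℓ H p q ≤ p * ℓ :=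
  hH.maxLength_le hpq fun _ hx => hH.chainLength_le hx

theorem maxLength_nonneg {p q : ℕ} (hpq : p ≤ q) : 0 ≤ maxLength ℓ H p q := by
  obtain ⟨x, -, hx⟩ := exists_isClosedChain hH.pos hpq 0
  exact (Finset.sum_nonneg fun i _ => hH.nonneg _ _).trans (hH.chainLength_le_maxLength hx)

/-- Appending a stationary step. -/
theorem maxLength_le_succ {p q : ℕ} (hpq : p ≤ q) :
    maxLength ℓ H p q ≤ maxLength ℓ H p (q + 1) := by
  refine hH.maxLength_le hpq fun x hx => ?_
  have hy : IsClosedChain ℓ p (q + 1) (fun i => x (min i q)) := by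
    refine ⟨by simp [hx.finish], fun i hi => ?_⟩
    rcases (Nat.lt_succ_iff.1 hi).lt_or_eq with h | rfl
    · simpa [h.le, Nat.succ_le_of_lt h] using hx.step i h
    · simp [hH.pos.le]
  refine le_trans (le_of_eq ?_) (hH.chainLength_le_maxLength hy)
  rw [chainLength, chainLength, Finset.sum_range_succ]
  simp only [min_self, le_add_iff_nonneg_right, zero_le, min_eq_right, hH.self, add_zero]
  refine Finset.sum_congr rfl fun i hi => ?_
  have h := Finset.mem_range.1 hi
  rw [min_eq_left h.le, min_eq_left (Nat.succ_le_of_lt h)]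

/-- Appending a step that makes a full turn. -/
theorem maxLength_le_succ_succ {p q : ℕ} (hpq : p ≤ q) :
    maxLength ℓ H p q ≤ maxLength ℓ H (p + 1) (q + 1) := by
  refine hH.maxLength_le hpq fun x hx => ?_
  have hy : IsClosedChain ℓ (p + 1) (q + 1) (fun i => if i ≤ q then x i else x q + ℓ) := by
    refine ⟨by simp [hx.finish]; ring, fun i hi => ?_⟩
    rcases (Nat.lt_succ_iff.1 hi).lt_or_eq with h | rfl
    · simpa [h.le, Nat.succ_le_of_lt h] using hx.step i h
    · simp [hH.pos.le]
  refine le_trans (le_of_eq ?_) (hH.chainLength_le_maxLength hy)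
  rw [chainLength, chainLength, Finset.sum_range_succ]
  simp only [le_refl, if_true, Nat.not_succ_le_self, if_false, hH.turn, add_zero]
  refine Finset.sum_congr rfl fun i hi => ?_
  have h := Finset.mem_range.1 hi
  rw [if_pos h.le, if_pos (Nat.succ_le_of_lt h)]

theorem maxLength_mono_right {p q q' : ℕ} (hpq : p ≤ q) (hq : q ≤ q') :
    maxLength ℓ H p q ≤ maxLength ℓ H p q' := by
  induction q', hq using Nat.le_induction with
  | base => exact le_rfl
  | succ n hn ih => exact ih.trans (hH.maxLength_le_succ (hpq.trans hn))

theorem maxLength_le_add_add {p q : ℕ} (hpq : p ≤ q) (m : ℕ) :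
    maxLength ℓ H p q ≤ maxLength ℓ H (p + m) (q + m) := by
  induction m with
  | zero => exact le_rfl
  | succ n ih => exact ih.trans (hH.maxLength_le_succ_succ (by omega))

end IsChordLength

/-! ### Periodic chains, crossings and homogeneity -/

/-- Chains continued periodically. -/
structure IsPeriodicChain (ℓ : ℝ) (p q : ℕ) (x : ℕ → ℝ) : Prop where
  period : ∀ i, x (i + q) = x i + p * ℓ
  step : ∀ i, x i ≤ x (i + 1) ∧ x (i + 1) ≤ x i + ℓ

theorem IsPeriodicChain.period_mul {p q : ℕ} {x : ℕ → ℝ} (hx : IsPeriodicChain ℓ p q x)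
    (N i : ℕ) : x (i + N * q) = x i + N * p * ℓ := by
  induction N with
  | zero => simp
  | succ N ih =>
    rw [show i + (N + 1) * q = i + N * q + q by ring, hx.period, ih]
    push_cast; ring

theorem IsPeriodicChain.isClosedChain {p q : ℕ} {x : ℕ → ℝ} (hx : IsPeriodicChain ℓ p q x)
    (N k : ℕ) : IsClosedChain ℓ (N * p) (N * q) (fun i => x (k + i)) :=
  ⟨by simp [hx.period_mul], fun i _ => hx.step (k + i)⟩

theorem IsClosedChain.exists_isPeriodicChain {p q : ℕ} {x : ℕ → ℝ} (hx : IsClosedChain ℓ p q x)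
    (hq : 0 < q) : ∃ y, IsPeriodicChain ℓ p q y ∧ ∀ i ≤ q, y i = x i := by
  refine ⟨fun i => x (i % q) + (i / q : ℕ) * (p * ℓ), ⟨fun i => ?_, fun i => ?_⟩, fun i hi => ?_⟩
  · simp [Nat.add_div_right _ hq]; ring
  · have hlt := Nat.mod_lt i hq
    have hs := hx.step _ hlt
    rcases (Nat.succ_le_of_lt hlt).lt_or_eq with h | h
    · have h0 : (i + 1) % q = i % q + 1 := by
        rw [Nat.add_mod, Nat.mod_eq_of_lt (show 1 < q by omega), Nat.mod_eq_of_lt h]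
      have h1 : (i + 1) / q = i / q := by
        refine Nat.div_eq_of_lt_le ?_ ?_
        · have := Nat.div_mul_le_self i q; omega
        · have := Nat.div_add_mod i q; rw [Nat.succ_mul, mul_comm]; omega
      rw [h0, h1]
      constructor <;> linarith
    · have e : i + 1 = q * (i / q + 1) := by
        have := Nat.div_add_mod i q; rw [Nat.mul_succ]; omega
      have h0 : (i + 1) % q = 0 := by rw [e]; simp
      have h1 : (i + 1) / q = i / q + 1 := by rw [e]; exact Nat.mul_div_cancel_left _ hq
      have h2 : x (i % q + 1) = x 0 + p * ℓ := by rw [← hx.finish]; congr 1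
      rw [h0, h1]
      push_cast
      constructor <;> linarith
  · rcases hi.lt_or_eq with h | rfl
    · simp [Nat.mod_eq_of_lt h, Nat.div_eq_of_lt h]
    · simp [Nat.div_self hq, hx.finish]

/-- A periodic chain of type `((N + 1) p, (N + 1) q)` meets its translate by `(p, q)`. -/
theorem IsPeriodicChain.exists_crossing {p q N : ℕ} {y : ℕ → ℝ}
    (hy : IsPeriodicChain ℓ ((N + 1) * p) ((N + 1) * q) y) :
    ∃ i, y i ≤ y (i + q) - p * ℓ ∧ y (i + 1 + q) - p * ℓ ≤ y (i + 1) := by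
  -- The displacement from the chain to its translate telescopes along each class modulo `q`.
  -- Without a passage from nonnegative to nonpositive it would be negative everywhere or positive
  -- from some index on, and either contradicts the zero sum.
  have hsum : ∀ j, ∑ i ∈ Finset.range (N + 1), (y (j + i * q + q) - p * ℓ - y (j + i * q)) = 0 := by
    intro j
    have h := Finset.sum_range_sub (fun i => y (j + i * q) - i * (p * ℓ)) (N + 1)
    rw [hy.period j] at h
    have h0 : ∀ i : ℕ, y (j + i * q + q) - p * ℓ - y (j + i * q) =
        (y (j + (i + 1) * q) - ((i + 1 : ℕ) : ℝ) * (p * ℓ)) - (y (j + i * q) - i * (p * ℓ)) := by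
      intro i
      rw [show j + (i + 1) * q = j + i * q + q by ring]
      push_cast; ring
    simp only [h0]
    rw [h]; push_cast; ring_nf
  by_contra! hcon
  have hstep : ∀ i, 0 ≤ y (i + q) - p * ℓ - y i → 0 < y (i + 1 + q) - p * ℓ - y (i + 1) := by
    intro i hi
    have := hcon i (by linarith)
    linarith
  obtain ⟨i, hi⟩ : ∃ i, 0 ≤ y (i + q) - p * ℓ - y i := by
    by_contra! hneg
    have := Finset.sum_neg (fun i (_ : i ∈ Finset.range (N + 1)) => hneg (0 + i * q))
      ⟨0, by simp⟩
    linarith [hsum 0]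
  have hall : ∀ k, 0 < y (i + 1 + k + q) - p * ℓ - y (i + 1 + k) := by
    intro k
    induction k with
    | zero => exact hstep i hi
    | succ k ih => exact hstep _ ih.le
  have := Finset.sum_pos (fun k (_ : k ∈ Finset.range (N + 1)) => hall (k * q)) ⟨0, by simp⟩
  linarith [hsum (i + 1)]

theorem chainLength_congr {q : ℕ} {x y : ℕ → ℝ} (h : ∀ i ≤ q, y i = x i) :
    chainLength H q x = chainLength H q y :=
  Finset.sum_congr rfl fun i hi => by
    have := Finset.mem_range.1 hi
    rw [h i this.le, h (i + 1) this]

namespace IsChordLength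

variable (hH : IsChordLength ℓ H)
include hH

theorem chainLength_add {p q : ℕ} {x : ℕ → ℝ} (hx : IsPeriodicChain ℓ p q x) (k : ℕ) :
    chainLength H q (fun i => x (k + i)) = chainLength H q x := by
  induction k with
  | zero => simp
  | succ k ih =>
    rw [← ih]
    have h1 := Finset.sum_range_succ (fun i => H (x (k + i)) (x (k + i + 1))) q
    rw [Finset.sum_range_succ'] at h1
    have h2 : H (x (k + q)) (x (k + q + 1)) = H (x k) (x (k + 1)) := by
      rw [show k + q + 1 = (k + 1) + q by ring, hx.period, hx.period, hH.shift_nat]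
    simp only [chainLength]
    simp only [add_zero, h2] at h1
    have h3 := add_right_cancel h1
    convert h3 using 4 <;> ring

theorem chainLength_mul {p q : ℕ} {x : ℕ → ℝ} (hx : IsPeriodicChain ℓ p q x) (N : ℕ) :
    chainLength H (N * q) x = N * chainLength H q x := by
  induction N with
  | zero => simp [chainLength]
  | succ N ih =>
    have h := hH.chainLength_add hx (N * q)
    simp only [chainLength] at *
    rw [Nat.succ_mul, Finset.sum_range_add, ih]
    push_cast
    simp only [add_assoc] at *
    rw [h]; ring

theorem mul_maxLength_le {p q : ℕ} (hpq : p ≤ q) (hq : 0 < q) {N : ℕ} (hN : 0 < N) :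
    N * maxLength ℓ H p q ≤ maxLength ℓ H (N * p) (N * q) := by
  have hN' : (0 : ℝ) < N := by exact_mod_cast hN
  rw [← le_div_iff₀' hN']
  refine hH.maxLength_le hpq fun x hx => ?_
  rw [le_div_iff₀' hN']
  obtain ⟨y, hy, hyx⟩ := hx.exists_isPeriodicChain hq
  rw [chainLength_congr hyx, ← hH.chainLength_mul hy]
  have := hy.isClosedChain N 0
  simp only [zero_add] at this
  exact hH.chainLength_le_maxLength this

/-- Cutting a chain at a crossing does not decrease the length. -/
theorem maxLength_succ_mul_le {p q : ℕ} (hpq : p ≤ q) (hq : 0 < q) {N : ℕ} (hN : 0 < N) :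
    maxLength ℓ H ((N + 1) * p) ((N + 1) * q) ≤
      maxLength ℓ H p q + maxLength ℓ H (N * p) (N * q) := by
  refine hH.maxLength_le (by gcongr) fun x hx => ?_
  obtain ⟨y, hy, hyx⟩ := hx.exists_isPeriodicChain (by positivity)
  rw [chainLength_congr hyx]
  obtain ⟨i, hi1, hi2⟩ := hy.exists_crossing
  -- Start the chain just after the crossing. The first `q` vertices are closed up to form `c1`, the
  -- remaining `N q` to form `c2`; only the two closing chords are new.
  rw [← hH.chainLength_add hy (i + 1)]
  obtain ⟨r, rfl⟩ : ∃ r, q = r + 1 := ⟨q - 1, by omega⟩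
  obtain ⟨M, hM⟩ : ∃ M, N * (r + 1) = M + 1 :=
    ⟨N * (r + 1) - 1, by have : 0 < N * (r + 1) := by positivity
                         omega⟩
  have htot : (N + 1) * (r + 1) = (r + 1) + (M + 1) := by rw [← hM]; ring
  have hper : ∀ j, y (j + (r + 1 + (M + 1))) = y j + (N + 1) * p * ℓ := by
    intro j; rw [← htot, hy.period]; push_cast; ring
  have hs1 := hy.step i
  have hs2 := hy.step (i + (r + 1))
  have er : i + 1 + (r + 1) = i + (r + 1) + 1 := by ring
  rw [er] at hi2
  have c1 : IsClosedChain ℓ p (r + 1)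
      (fun j => if j ≤ r then y (i + 1 + j) else y (i + 1) + p * ℓ) := by
    refine ⟨by simp, fun j hj => ?_⟩
    rcases (Nat.lt_succ_iff.1 hj).lt_or_eq with h | rfl
    · simpa [h.le, Nat.succ_le_of_lt h, add_assoc] using hy.step (i + 1 + j)
    · have e1 : i + 1 + j = i + (j + 1) := by ring
      simp only [le_refl, if_true, Nat.not_succ_le_self, if_false, e1]
      constructor <;> linarith
  have c2 : IsClosedChain ℓ (N * p) (M + 1)
      (fun j => if j ≤ M then y (i + (r + 1) + 1 + j)
        else y (i + (r + 1) + 1) + (N * p : ℕ) * ℓ) := by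
    refine ⟨by simp, fun j hj => ?_⟩
    rcases (Nat.lt_succ_iff.1 hj).lt_or_eq with h | rfl
    · simpa [h.le, Nat.succ_le_of_lt h, add_assoc] using hy.step (i + (r + 1) + 1 + j)
    · have e1 : i + (r + 1) + 1 + j = i + (r + 1 + (j + 1)) := by ring
      simp only [le_refl, if_true, Nat.not_succ_le_self, if_false, e1, hper]
      push_cast
      constructor <;> linarith
  have l1 := hH.chainLength_le_maxLength c1
  have l2 := hH.chainLength_le_maxLength c2
  rw [hM]
  refine le_trans ?_ (add_le_add l1 l2)
  have s1 : chainLength H (r + 1) (fun j => if j ≤ r then y (i + 1 + j) else y (i + 1) + p * ℓ) =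
      ∑ j ∈ Finset.range r, H (y (i + 1 + j)) (y (i + 1 + (j + 1))) +
        H (y (i + (r + 1)) - p * ℓ) (y (i + 1)) := by
    rw [chainLength, Finset.sum_range_succ]
    congr 1
    · refine Finset.sum_congr rfl fun j hj => ?_
      have := Finset.mem_range.1 hj
      rw [if_pos this.le, if_pos (Nat.succ_le_of_lt this)]
    · rw [if_pos le_rfl, if_neg (Nat.not_succ_le_self r),
        ← hH.shift_nat p (y (i + (r + 1)) - p * ℓ), sub_add_cancel,
        show i + 1 + r = i + (r + 1) by ring]
  have s2 : chainLength H (M + 1) (fun j => if j ≤ M then y (i + (r + 1) + 1 + j)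
        else y (i + (r + 1) + 1) + (N * p : ℕ) * ℓ) =
      ∑ j ∈ Finset.range M, H (y (i + (r + 1) + 1 + j)) (y (i + (r + 1) + 1 + (j + 1))) +
        H (y i) (y (i + (r + 1) + 1) - p * ℓ) := by
    rw [chainLength, Finset.sum_range_succ]
    congr 1
    · refine Finset.sum_congr rfl fun j hj => ?_
      have := Finset.mem_range.1 hj
      rw [if_pos this.le, if_pos (Nat.succ_le_of_lt this)]
    · rw [if_pos le_rfl, if_neg (Nat.not_succ_le_self M), ← hH.shift_nat ((N + 1) * p) (y i),
        show i + (r + 1) + 1 + M = i + (r + 1 + (M + 1)) by ring, hper]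
      push_cast
      congr 1; ring
  have s3 : chainLength H ((N + 1) * (r + 1)) (fun j => y (i + 1 + j)) =
      ∑ j ∈ Finset.range r, H (y (i + 1 + j)) (y (i + 1 + (j + 1))) +
        H (y (i + (r + 1)) - p * ℓ) (y (i + (r + 1) + 1) - p * ℓ) +
      (∑ j ∈ Finset.range M, H (y (i + (r + 1) + 1 + j)) (y (i + (r + 1) + 1 + (j + 1))) +
        H (y i) (y (i + 1))) := by
    rw [htot, chainLength, Finset.sum_range_add, Finset.sum_range_succ, Finset.sum_range_succ]
    congr 2
    · rw [← hH.shift_nat p (y (i + (r + 1)) - p * ℓ), sub_add_cancel, sub_add_cancel]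
      congr 2; ring
    · refine Finset.sum_congr rfl fun j _ => ?_
      congr 2 <;> ring
    · rw [show i + 1 + (r + 1 + M) = i + (r + 1 + (M + 1)) by ring,
        show i + 1 + (r + 1 + M + 1) = i + 1 + (r + 1 + (M + 1)) by ring, hper, hper]
      exact_mod_cast hH.shift_nat ((N + 1) * p) (y i) (y (i + 1))
  rw [s1, s2, s3]
  -- At the crossing the arc of the translated step is nested in the arc of the original one, so
  -- exchanging endpoints turns the nested pair into an overlapping pair, which is at least as long.
  have := hH.quadrangle (y i) (y (i + (r + 1)) - p * ℓ) (y (i + (r + 1) + 1) - p * ℓ) (y (i + 1))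
    hi1 (by linarith) hi2 hs1.2
  linarith

/-- Repeating a chain gives one inequality; cutting off one block of type `(p, q)` at a time gives
the other. The cut works for every chain, so no maximizer is required. -/
theorem maxLength_mul {p q : ℕ} (hpq : p ≤ q) (hq : 0 < q) {N : ℕ} (hN : 0 < N) :
    maxLength ℓ H (N * p) (N * q) = N * maxLength ℓ H p q := by
  refine le_antisymm ?_ (hH.mul_maxLength_le hpq hq hN)
  induction N, hN using Nat.le_induction with
  | base => simp
  | succ n hn ih =>
    have := hH.maxLength_succ_mul_le hpq hq (N := n) hn
    push_cast
    linarith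

/-- The maximal length per turn does not increase with the rotation number. -/
theorem maxLength_cross_le {p q p' q' : ℕ} (hpq : p ≤ q) (hpq' : p' ≤ q') (hp : 0 < p)
    (hp' : 0 < p') (h : p * q' ≤ p' * q) :
    p * maxLength ℓ H p' q' ≤ p' * maxLength ℓ H p q := by
  rw [← hH.maxLength_mul hpq (by omega) hp', ← hH.maxLength_mul hpq' (by omega) hp, mul_comm p' p]
  exact hH.maxLength_mono_right (by gcongr) h

/-- Scaling each type by the other's `q - p` makes these differences equal, after which the two
types differ only by full turns. -/
theorem maxLength_cross_le' {p q p' q' : ℕ} (hpq : p < q) (hpq' : p' < q')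
    (h : p * q' ≤ p' * q) :
    ((q' : ℝ) - p') * maxLength ℓ H p q ≤ ((q : ℝ) - p) * maxLength ℓ H p' q' := by
  obtain ⟨d, rfl⟩ := Nat.exists_eq_add_of_lt hpq
  obtain ⟨d', rfl⟩ := Nat.exists_eq_add_of_lt hpq'
  have h1 := hH.maxLength_mul hpq.le (by omega) (Nat.succ_pos d')
  have h2 := hH.maxLength_mul hpq'.le (by omega) (Nat.succ_pos d)
  have h3 : (d' + 1) * p ≤ (d + 1) * p' := by nlinarith
  obtain ⟨m, hm⟩ := Nat.exists_eq_add_of_le h3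
  have h4 := hH.maxLength_le_add_add (Nat.mul_le_mul_left (d' + 1) hpq.le) m
  rw [h1, ← hm, show (d' + 1) * (p + d + 1) + m = (d + 1) * (p' + d' + 1) by
    rw [show (d + 1) * (p' + d' + 1) = (d + 1) * p' + (d + 1) * (d' + 1) by ring, hm]; ring,
    h2] at h4
  push_cast at *
  convert h4 using 2 <;> ring

end IsChordLength

end

end Billiard

/-! ### The β-function at rational and irrational rotation numbers -/

namespace Billiard

section

variable {ℓ : ℝ} {ξ : ℝ → Plane}

theorem IsConfiguration.isClosedChain {s : ℝ} {p q : ℕ} {x : ℕ → ℝ}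
    (hx : IsConfiguration ℓ s p q x) : IsClosedChain ℓ p q x :=
  ⟨by rw [hx.finish, hx.start]; simp, hx.step⟩

theorem IsClosedChain.isConfiguration {p q : ℕ} {x : ℕ → ℝ}
    (hx : IsClosedChain ℓ p q x) : IsConfiguration ℓ (x 0) p q x :=
  ⟨rfl, by rw [hx.finish]; simp, hx.step⟩

theorem sum_gen_eq (q : ℕ) (x : ℕ → ℝ) : ∑ i ∈ Finset.range q, gen ξ (x i) (x (i + 1)) =
    -chainLength (fun x y => ‖ξ x - ξ y‖) q x := by
  simp [gen, chainLength]

theorem sInf_barrier_eq (hH : IsChordLength ℓ fun x y => ‖ξ x - ξ y‖) {p q : ℕ} (hpq : p ≤ q) :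
    sInf ((fun s => barrier ξ ℓ s p q) '' Icc 0 ℓ) =
      -maxLength ℓ (fun x y => ‖ξ x - ξ y‖) p q := by
  set F := maxLength ℓ (fun x y => ‖ξ x - ξ y‖) p q with hF
  have hlow : ∀ s, ∀ A ∈ {A : ℝ | ∃ x : ℕ → ℝ, IsConfiguration ℓ s p q x ∧
      A = ∑ i ∈ Finset.range q, gen ξ (x i) (x (i + 1))}, -F ≤ A := by
    rintro s _ ⟨x, hx, rfl⟩
    rw [sum_gen_eq]
    exact neg_le_neg (hH.chainLength_le_maxLength hx.isClosedChain)
  have hb : ∀ s, -F ≤ barrier ξ ℓ s p q := by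
    intro s
    refine le_csInf ?_ (hlow s)
    obtain ⟨x, rfl, hx⟩ := exists_isClosedChain hH.pos hpq s
    exact ⟨_, x, hx.isConfiguration, rfl⟩
  refine le_antisymm ?_ ?_
  · rw [le_neg]
    refine hH.maxLength_le hpq fun x hx => ?_
    rw [le_neg]
    -- The barrier is minimized over starting points in `[0, ℓ]` only, so the chain is moved there
    -- by whole turns.
    set k : ℤ := ⌊x 0 / ℓ⌋ with hk
    set y : ℕ → ℝ := fun i => x i + (-k : ℤ) * ℓ with hy
    have hyc : IsClosedChain ℓ p q y :=
      ⟨by simp only [hy, hx.finish]; ring, fun i hi => by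
        have := hx.step i hi
        simp only [hy]
        constructor <;> linarith⟩
    have hlen : chainLength (fun x y => ‖ξ x - ξ y‖) q y =
        chainLength (fun x y => ‖ξ x - ξ y‖) q x :=
      Finset.sum_congr rfl fun i _ => hH.shift_int (-k) (x i) (x (i + 1))
    have hy0 : y 0 ∈ Icc 0 ℓ := by
      have h1 := (le_div_iff₀ hH.pos).1 (Int.floor_le (x 0 / ℓ))
      have h2 := (div_lt_iff₀ hH.pos).1 (Int.lt_floor_add_one (x 0 / ℓ))
      rw [← hk] at h1 h2
      simp only [hy]
      push_cast
      constructor <;> linarith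
    calc sInf ((fun s => barrier ξ ℓ s p q) '' Icc 0 ℓ) ≤ barrier ξ ℓ (y 0) p q :=
          csInf_le ⟨-F, by rintro _ ⟨s, -, rfl⟩; exact hb s⟩ ⟨y 0, hy0, rfl⟩
      _ ≤ -chainLength (fun x y => ‖ξ x - ξ y‖) q x :=
          csInf_le ⟨-F, hlow _⟩ ⟨y, hyc.isConfiguration, by rw [sum_gen_eq, hlen]⟩
  · refine le_csInf ⟨_, 0, ⟨le_rfl, hH.pos.le⟩, rfl⟩ ?_
    rintro _ ⟨s, -, rfl⟩
    exact hb s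

/-- Homogeneity frees the formula from lowest terms: the common factor of `p` and `q` cancels. -/
theorem betaRat_eq (hH : IsChordLength ℓ fun x y => ‖ξ x - ξ y‖) {p q : ℕ} (hpq : p ≤ q)
    (hp : 0 < p) :
    betaRat ξ ℓ ((p : ℚ) / q) = -maxLength ℓ (fun x y => ‖ξ x - ξ y‖) p q / q := by
  have hq : 0 < q := by omega
  set g := p.gcd q with hg
  have hg0 : 0 < g := Nat.gcd_pos_of_pos_left q hp
  obtain ⟨a, ha⟩ := Nat.gcd_dvd_left p q
  obtain ⟨b, hb⟩ := Nat.gcd_dvd_right p q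
  rw [← hg] at ha hb
  have hcop : Nat.Coprime a b := by
    have h1 := Nat.coprime_div_gcd_div_gcd (m := p) (n := q) hg0
    rw [← hg] at h1
    rwa [ha, hb, Nat.mul_div_cancel_left _ hg0, Nat.mul_div_cancel_left _ hg0] at h1
  have hb0 : 0 < b := Nat.pos_of_ne_zero (by rintro rfl; omega)
  have hab : a ≤ b := by
    by_contra! h
    have := Nat.mul_lt_mul_of_pos_left h hg0
    omega
  have hr : (p : ℚ) / q = (a : ℚ) / b := by
    rw [ha, hb]; push_cast
    exact mul_div_mul_left _ _ (by positivity)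
  have hnum : ((a : ℚ) / b).num = (a : ℤ) := by
    have := Rat.num_div_eq_of_coprime (a := (a : ℤ)) (b := (b : ℤ)) (by exact_mod_cast hb0)
      (by simpa using hcop)
    simpa only [Int.cast_natCast] using this
  have hden : ((a : ℚ) / b).den = b := by
    have := Rat.den_div_eq_of_coprime (a := (a : ℤ)) (b := (b : ℤ)) (by exact_mod_cast hb0)
      (by simpa using hcop)
    simpa only [Int.cast_natCast, Nat.cast_inj] using this
  rw [hr, betaRat, hnum, hden, sInf_barrier_eq hH hab, ha, hb, hH.maxLength_mul hab hb0 hg0]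
  have : (b : ℝ) ≠ 0 := by positivity
  have : (g : ℝ) ≠ 0 := by positivity
  push_cast
  field_simp

theorem exists_nat_div {r : ℚ} (h0 : 0 < r) (h1 : r ≤ 1) :
    ∃ p q : ℕ, 0 < p ∧ p ≤ q ∧ r = (p : ℚ) / q := by
  refine ⟨r.num.toNat, r.den, ?_, ?_, ?_⟩
  · have := Rat.num_pos.2 h0; omega
  · have := Rat.num_le_denom_iff.2 h1; omega
  · have h := Rat.num_pos.2 h0
    conv_lhs => rw [← Rat.num_div_den r]
    congr 1
    have : ((r.num.toNat : ℤ) : ℚ) = (r.num : ℚ) := by rw [Int.toNat_of_nonneg h.le]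
    exact_mod_cast this.symm

theorem betaRat_bounds (hH : IsChordLength ℓ fun x y => ‖ξ x - ξ y‖) {a : ℚ} (ha : 0 < a)
    (h1 : a ≤ 1) : 0 ≤ -betaRat ξ ℓ a ∧ -betaRat ξ ℓ a ≤ ℓ := by
  obtain ⟨p, q, hp, hpq, rfl⟩ := exists_nat_div ha h1
  have hq : (0 : ℝ) < q := by exact_mod_cast hp.trans_le hpq
  have hpq' : (p : ℝ) ≤ q := by exact_mod_cast hpq
  rw [betaRat_eq hH hpq hp, neg_div, neg_neg, div_le_iff₀ hq]
  exact ⟨div_nonneg (hH.maxLength_nonneg hpq) hq.le,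
    (hH.maxLength_le_mul hpq).trans (by nlinarith [hH.pos])⟩

theorem betaRat_mul_le (hH : IsChordLength ℓ fun x y => ‖ξ x - ξ y‖) {a b : ℚ} (ha : 0 < a)
    (hab : a ≤ b) (hb : b ≤ 1) : a * -betaRat ξ ℓ b ≤ b * -betaRat ξ ℓ a := by
  obtain ⟨p, q, hp, hpq, rfl⟩ := exists_nat_div ha (hab.trans hb)
  obtain ⟨p', q', hp', hpq', rfl⟩ := exists_nat_div (ha.trans_le hab) hb
  have hq : 0 < q := hp.trans_le hpq
  have hq' : 0 < q' := hp'.trans_le hpq'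
  rw [div_le_div_iff₀ (by exact_mod_cast hq) (by exact_mod_cast hq')] at hab
  have h := hH.maxLength_cross_le hpq hpq' hp hp' (by exact_mod_cast hab)
  rw [betaRat_eq hH hpq hp, betaRat_eq hH hpq' hp']
  push_cast
  have hqr : (0 : ℝ) < q := by exact_mod_cast hq
  have hqr' : (0 : ℝ) < q' := by exact_mod_cast hq'
  rw [neg_div, neg_neg, neg_div, neg_neg, div_mul_div_comm, div_mul_div_comm, mul_comm (q' : ℝ)]
  exact div_le_div_of_nonneg_right h (by positivity)

theorem one_sub_mul_betaRat_le (hH : IsChordLength ℓ fun x y => ‖ξ x - ξ y‖) {a b : ℚ}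
    (ha : 0 < a) (hab : a ≤ b) (hb : b < 1) :
    (1 - b) * -betaRat ξ ℓ a ≤ (1 - a) * -betaRat ξ ℓ b := by
  have ha1 : a < 1 := hab.trans_lt hb
  obtain ⟨p, q, hp, hpq, rfl⟩ := exists_nat_div ha ha1.le
  obtain ⟨p', q', hp', hpq', rfl⟩ := exists_nat_div (ha.trans_le hab) hb.le
  have hq : 0 < q := hp.trans_le hpq
  have hq' : 0 < q' := hp'.trans_le hpq'
  rw [div_le_div_iff₀ (by exact_mod_cast hq) (by exact_mod_cast hq')] at hab
  rw [div_lt_one (by exact_mod_cast hq)] at ha1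
  rw [div_lt_one (by exact_mod_cast hq')] at hb
  have h := hH.maxLength_cross_le' (by exact_mod_cast ha1) (by exact_mod_cast hb)
    (by exact_mod_cast hab)
  rw [betaRat_eq hH hpq hp, betaRat_eq hH hpq' hp']
  push_cast
  have hqr : (0 : ℝ) < q := by exact_mod_cast hq
  have hqr' : (0 : ℝ) < q' := by exact_mod_cast hq'
  rw [neg_div, neg_neg, neg_div, neg_neg, one_sub_div hqr.ne', one_sub_div hqr'.ne',
    div_mul_div_comm, div_mul_div_comm, mul_comm (q' : ℝ)]
  exact div_le_div_of_nonneg_right h (by positivity)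

/-- Monotonicity of `-β(r) / r` bounds the increase of `-β`, that of `-β(r) / (1 - r)` bounds its
decrease; staying `c` away from `0` and `1` keeps both constants finite. -/
theorem abs_betaRat_sub_le (hH : IsChordLength ℓ fun x y => ‖ξ x - ξ y‖) {c : ℝ} (hc : 0 < c)
    {a b : ℚ} (ha : c ≤ a) (hab : a ≤ b) (hb : (b : ℝ) ≤ 1 - c) :
    |betaRat ξ ℓ a - betaRat ξ ℓ b| ≤ ℓ / c * (b - a) := by
  have ha0 : (0 : ℝ) < a := hc.trans_le ha
  have hab' : (a : ℝ) ≤ b := by exact_mod_cast hab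
  have ha0' : 0 < a := by exact_mod_cast ha0
  have hb1 : b < 1 := by
    have : (b : ℝ) < 1 := by linarith
    exact_mod_cast this
  have h1 := betaRat_mul_le hH ha0' hab hb1.le
  have h2 := one_sub_mul_betaRat_le hH ha0' hab hb1
  obtain ⟨h3, h4⟩ := betaRat_bounds hH ha0' (hab.trans hb1.le)
  rw [div_mul_eq_mul_div, le_div_iff₀ hc]
  set f := -betaRat ξ ℓ a
  set g := -betaRat ξ ℓ b
  have e : betaRat ξ ℓ a - betaRat ξ ℓ b = g - f := by simp only [f, g]; ring
  rw [e]
  have h5 : f * (b - a) ≤ ℓ * (b - a) := mul_le_mul_of_nonneg_right h4 (by linarith)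
  rcases abs_cases (g - f) with ⟨h, h'⟩ | ⟨h, h'⟩
  · rw [h]
    have : (g - f) * c ≤ (g - f) * a := by gcongr
    nlinarith
  · rw [h]
    have : -(g - f) * c ≤ -(g - f) * (1 - a) := by
      refine mul_le_mul_of_nonneg_left ?_ (by linarith)
      linarith
    nlinarith

theorem exists_tendsto_betaRat (hH : IsChordLength ℓ fun x y => ‖ξ x - ξ y‖) {w : ℝ}
    (hw : w ∈ Ioo (0 : ℝ) (1 / 2)) :
    ∃ L, Tendsto (betaRat ξ ℓ) (comap (fun r : ℚ => (r : ℝ)) (𝓝 w)) (𝓝 L) := by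
  obtain ⟨hw0, hw1⟩ := hw
  have hne : (comap (fun r : ℚ => (r : ℝ)) (𝓝 w)).NeBot :=
    Rat.isDenseEmbedding_coe_real.isDenseInducing.comap_nhds_neBot w
  rw [← cauchy_map_iff_exists_tendsto, Metric.cauchy_iff]
  refine ⟨hne.map _, fun ε hε => ?_⟩
  -- Since `w < 1 / 2`, every point within `w / 2` of `w` lies in `[c, 1 - c]`.
  set c := w / 2 with hc
  have hc0 : 0 < c := by positivity
  set δ := min c (ε * c / (4 * ℓ)) with hδ
  have hℓ := hH.pos
  have hδ0 : 0 < δ := by positivity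
  refine ⟨betaRat ξ ℓ '' ((fun r : ℚ => (r : ℝ)) ⁻¹' Metric.ball w δ),
    image_mem_map (preimage_mem_comap (Metric.ball_mem_nhds w hδ0)), ?_⟩
  have key : ∀ a b : ℚ, dist (a : ℝ) w < δ → dist (b : ℝ) w < δ → a ≤ b →
      |betaRat ξ ℓ a - betaRat ξ ℓ b| < ε := by
    intro a b ha hb hab
    rw [Real.dist_eq, abs_lt] at ha hb
    have h1 : δ ≤ c := min_le_left _ _
    have h2 : δ ≤ ε * c / (4 * ℓ) := min_le_right _ _
    rw [le_div_iff₀ (by positivity)] at h2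
    refine (abs_betaRat_sub_le hH hc0 (by linarith) hab (by linarith)).trans_lt ?_
    rw [div_mul_eq_mul_div, div_lt_iff₀ hc0]
    have : ℓ * (b - a) < ℓ * (2 * δ) := by
      refine mul_lt_mul_of_pos_left (by linarith) hℓ
    nlinarith [mul_pos hℓ hδ0]
  rintro _ ⟨a, ha, rfl⟩ _ ⟨b, hb, rfl⟩
  rcases le_total a b with h | h
  · exact key a b ha hb h
  · rw [dist_comm]
    exact key b a hb ha h

theorem beta_ratCast (r : ℚ) : beta ξ ℓ r = betaRat ξ ℓ r := by
  have h : ∃ r' : ℚ, (r' : ℝ) = r := ⟨r, rfl⟩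
  rw [beta, dif_pos h]
  congr 1
  exact_mod_cast h.choose_spec

theorem tendsto_beta (hH : IsChordLength ℓ fun x y => ‖ξ x - ξ y‖) {w : ℝ} (hi : Irrational w)
    (hw : w ∈ Ioo (0 : ℝ) (1 / 2)) :
    Tendsto (betaRat ξ ℓ) (comap (fun r : ℚ => (r : ℝ)) (𝓝 w)) (𝓝 (beta ξ ℓ w)) := by
  have h : ¬ ∃ r : ℚ, (r : ℝ) = w := fun ⟨r, hr⟩ => hi ⟨r, hr⟩
  rw [beta, dif_neg h]
  exact tendsto_nhds_limUnder (exists_tendsto_betaRat hH hw)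

/-- `-β(h) / h` lies between the maximal perimeters of inscribed `n`-gons and `n + 1`-gons. -/
theorem beta_mem_Icc (hH : IsChordLength ℓ fun x y => ‖ξ x - ξ y‖) {n : ℕ} (hn : 2 ≤ n) {h : ℝ}
    (h1 : 1 / ((n : ℝ) + 1) ≤ h) (h2 : h ≤ 1 / n) :
    -beta ξ ℓ h ∈ Icc (h * maxLength ℓ (fun x y => ‖ξ x - ξ y‖) 1 n)
      (h * maxLength ℓ (fun x y => ‖ξ x - ξ y‖) 1 (n + 1)) := by
  have hn0 : (0 : ℝ) < n := by positivity
  have hrat : ∀ r : ℚ, 1 / ((n : ℝ) + 1) ≤ r → (r : ℝ) ≤ 1 / n →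
      -betaRat ξ ℓ r ∈ Icc (r * maxLength ℓ (fun x y => ‖ξ x - ξ y‖) 1 n)
      (r * maxLength ℓ (fun x y => ‖ξ x - ξ y‖) 1 (n + 1)) := by
    intro r hr1 hr2
    have e1 : ((1 : ℕ) : ℚ) / ((n + 1 : ℕ) : ℚ) ≤ r := by
      have : (((1 : ℕ) / ((n + 1 : ℕ)) : ℚ) : ℝ) ≤ r := by push_cast; exact hr1
      exact_mod_cast this
    have e2 : r ≤ ((1 : ℕ) : ℚ) / (n : ℚ) := by
      have : (r : ℝ) ≤ (((1 : ℕ) / (n : ℕ) : ℚ) : ℝ) := by push_cast; exact hr2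
      exact_mod_cast this
    have e3 : ((1 : ℕ) : ℚ) / (n : ℚ) ≤ 1 := by
      rw [div_le_one (by positivity)]; exact_mod_cast (by omega : 1 ≤ n)
    have e4 : (0 : ℚ) < ((1 : ℕ) : ℚ) / ((n + 1 : ℕ) : ℚ) := by positivity
    have k1 := betaRat_mul_le hH (e4.trans_le e1) e2 e3
    have k2 := betaRat_mul_le hH e4 e1 (e2.trans e3)
    rw [betaRat_eq hH (by omega) one_pos] at k1 k2
    push_cast at k1 k2
    rw [neg_div, neg_neg] at k1 k2
    constructor
    · calc r * maxLength ℓ (fun x y => ‖ξ x - ξ y‖) 1 n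
          = n * (r * (maxLength ℓ (fun x y => ‖ξ x - ξ y‖) 1 n / n)) := by field_simp
        _ ≤ n * (1 / n * -betaRat ξ ℓ r) := by gcongr
        _ = _ := by field_simp
    · calc -betaRat ξ ℓ r = ((n : ℝ) + 1) * (1 / (n + 1) * -betaRat ξ ℓ r) := by field_simp
        _ ≤ (n + 1) * (r * (maxLength ℓ (fun x y => ‖ξ x - ξ y‖) 1 (n + 1) / (n + 1))) := by
          gcongr
        _ = _ := by field_simp
  by_cases hi : Irrational h
  · have hw : h ∈ Ioo (0 : ℝ) (1 / 2) := by
      refine ⟨lt_of_lt_of_le (by positivity) h1, lt_of_le_of_ne (h2.trans ?_) ?_⟩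
      · exact one_div_le_one_div_of_le two_pos (by exact_mod_cast hn)
      · rintro rfl
        exact hi ⟨1 / 2, by norm_num⟩
    have hne : (comap (fun r : ℚ => (r : ℝ)) (𝓝 h)).NeBot :=
      Rat.isDenseEmbedding_coe_real.isDenseInducing.comap_nhds_neBot h
    have h1' : 1 / ((n : ℝ) + 1) < h := lt_of_le_of_ne h1 fun e => hi ⟨1 / (n + 1), by
      rw [← e]; push_cast; rfl⟩
    have h2' : h < 1 / (n : ℝ) := lt_of_le_of_ne h2 fun e => hi ⟨1 / n, by
      rw [e]; push_cast; rfl⟩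
    have hev : ∀ᶠ r : ℚ in comap (fun r : ℚ => (r : ℝ)) (𝓝 h),
        1 / ((n : ℝ) + 1) ≤ r ∧ (r : ℝ) ≤ 1 / n :=
      (tendsto_comap (f := fun r : ℚ => (r : ℝ)) (x := 𝓝 h)).eventually
        ((lt_mem_nhds h1').and (gt_mem_nhds h2')) |>.mono fun r hr => ⟨hr.1.le, hr.2.le⟩
    have ht := (tendsto_beta hH hi hw).neg
    have hid : Tendsto (fun r : ℚ => (r : ℝ)) (comap (fun r : ℚ => (r : ℝ)) (𝓝 h)) (𝓝 h) :=
      tendsto_comap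
    exact ⟨le_of_tendsto_of_tendsto (hid.mul_const _) ht
        (hev.mono fun r hr => (hrat r hr.1 hr.2).1),
      le_of_tendsto_of_tendsto ht (hid.mul_const _)
        (hev.mono fun r hr => (hrat r hr.1 hr.2).2)⟩
  · obtain ⟨r, rfl⟩ := not_not.1 hi
    rw [beta_ratCast]
    exact hrat r h1 h2

end

end Billiard

namespace Billiard

/-! ### Continuous periodic functions -/

theorem exists_bound_of_periodic {E : Type*} [SeminormedAddCommGroup E] {f : ℝ → E} {ℓ : ℝ}
    (hp : Function.Periodic f ℓ) (hℓ : ℓ ≠ 0) (hf : Continuous f) :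
    ∃ B, 0 < B ∧ ∀ x, ‖f x‖ ≤ B := by
  obtain ⟨B, hB0, hB⟩ := (hp.isBounded_of_continuous hℓ hf).exists_pos_norm_le
  exact ⟨B, hB0, fun x => hB _ ⟨x, rfl⟩⟩

theorem exists_uniform_of_periodic {f : ℝ → ℝ} {ℓ : ℝ} (hp : Function.Periodic f ℓ) (hℓ : 0 < ℓ)
    (hf : Continuous f) {ε : ℝ} (hε : 0 < ε) :
    ∃ η > 0, ∀ x t, 0 ≤ t → t ≤ η → |f (x + t) - f x| ≤ ε := by
  have huc := isCompact_Icc.uniformContinuousOn_of_continuous (s := Icc 0 (2 * ℓ)) hf.continuousOn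
  rw [Metric.uniformContinuousOn_iff] at huc
  obtain ⟨δ, hδ, h⟩ := huc ε hε
  refine ⟨min (δ / 2) ℓ, by positivity, fun x t ht0 ht => ?_⟩
  have h1 : t ≤ δ / 2 := ht.trans (min_le_left _ _)
  have h2 : t ≤ ℓ := ht.trans (min_le_right _ _)
  have hg : Function.Periodic (fun x t => f (x + t)) ℓ := fun x => by
    funext t
    change f (x + ℓ + t) = f (x + t)
    rw [add_right_comm, hp]
  obtain ⟨y, hy, hxy⟩ := hg.exists_mem_Ico₀ hℓ x
  have e1 : f (x + t) = f (y + t) := congrFun hxy t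
  have e2 : f x = f y := by simpa using congrFun hxy 0
  rw [e1, e2, ← Real.dist_eq]
  refine (h _ ⟨by linarith [hy.1], by linarith [hy.2]⟩ _ ⟨hy.1, by linarith [hy.2]⟩ ?_).le
  rw [Real.dist_eq, add_sub_cancel_left, abs_of_nonneg ht0]
  linarith

/-- Nonpositivity on `[0, η]` from the derivative. -/
theorem nonpos_of_hasDerivAt_nonpos {f f' : ℝ → ℝ} {η : ℝ} (hf : ∀ t, HasDerivAt f (f' t) t)
    (h0 : f 0 ≤ 0) (h : ∀ t ∈ Icc 0 η, f' t ≤ 0) : ∀ t ∈ Icc 0 η, f t ≤ 0 := by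
  intro t ht
  have hanti : AntitoneOn f (Icc 0 η) := by
    refine antitoneOn_of_deriv_nonpos (convex_Icc 0 η)
      (fun s _ => (hf s).continuousAt.continuousWithinAt)
      (fun s _ => (hf s).differentiableAt.differentiableWithinAt) fun s hs => ?_
    rw [(hf s).deriv]
    exact h s (interior_subset hs)
  exact (hanti ⟨le_rfl, ht.1.trans ht.2⟩ ht ht.1).trans h0

/-! ### Short arcs and their chords -/

section

variable {E : Type*} [NormedAddCommGroup E] [InnerProductSpace ℝ E] {ξ : ℝ → E} {ℓ : ℝ}

theorem hasDerivAt_of_smooth (hs : ContDiff ℝ ∞ ξ) (s : ℝ) : HasDerivAt ξ (deriv ξ s) s :=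
  ((contDiff_infty_iff_deriv.1 hs).1 s).hasDerivAt

theorem smooth_deriv (hs : ContDiff ℝ ∞ ξ) : ContDiff ℝ ∞ (deriv ξ) :=
  (contDiff_infty_iff_deriv.1 hs).2

theorem periodic_deriv (hp : Function.Periodic ξ ℓ) : Function.Periodic (deriv ξ) ℓ := by
  intro x
  have : (fun y => ξ (y + ℓ)) = ξ := funext hp
  rw [← deriv_comp_add_const, this]

/-- The curvature of a curve that is parametrized by arc length. -/
noncomputable def curv (ξ : ℝ → E) (s : ℝ) : ℝ := ‖deriv (deriv ξ) s‖

/-- The `2/3`-th power of the curvature, the density of the affine arc length. -/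
noncomputable def affDens (ξ : ℝ → E) (s : ℝ) : ℝ := (curv ξ s ^ (1 / 3 : ℝ)) ^ 2

theorem affDens_nonneg (s : ℝ) : 0 ≤ affDens ξ s := sq_nonneg _

theorem rpow_third_pow (s : ℝ) : (curv ξ s ^ (1 / 3 : ℝ)) ^ 3 = curv ξ s := by
  rw [← Real.rpow_natCast, ← Real.rpow_mul (show 0 ≤ curv ξ s from norm_nonneg _)]
  norm_num

theorem affDens_pow (s : ℝ) : affDens ξ s ^ 3 = curv ξ s ^ 2 := by
  rw [affDens, ← pow_mul, mul_comm, pow_mul, rpow_third_pow]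

theorem continuous_curv (hs : ContDiff ℝ ∞ ξ) : Continuous (curv ξ) :=
  (smooth_deriv (smooth_deriv hs)).continuous.norm

theorem continuous_rpow_third (hs : ContDiff ℝ ∞ ξ) :
    Continuous fun s => curv ξ s ^ (1 / 3 : ℝ) :=
  (continuous_curv hs).rpow_const fun _ => Or.inr (by norm_num)

theorem continuous_affDens (hs : ContDiff ℝ ∞ ξ) : Continuous (affDens ξ) :=
  (continuous_rpow_third hs).pow 2

theorem periodic_curv (hp : Function.Periodic ξ ℓ) : Function.Periodic (curv ξ) ℓ := fun x => by
  rw [curv, curv, periodic_deriv (periodic_deriv hp)]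

theorem periodic_affDens (hp : Function.Periodic ξ ℓ) : Function.Periodic (affDens ξ) ℓ :=
  fun x => by rw [affDens, affDens, periodic_curv hp]

theorem inner_deriv_deriv (hs : ContDiff ℝ ∞ ξ) (hu : ∀ s, ‖deriv ξ s‖ = 1) (s : ℝ) :
    inner ℝ (deriv ξ s) (deriv (deriv ξ) s) = 0 := by
  have h := (hasDerivAt_of_smooth (smooth_deriv hs) s).norm_sq
  have hc : (‖deriv ξ ·‖ ^ 2 : ℝ → ℝ) = fun _ => 1 := by
    funext t; simp [hu]
  rw [hc] at h
  have := h.unique (hasDerivAt_const s (1 : ℝ))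
  linarith

theorem inner_deriv_deriv₃ (hs : ContDiff ℝ ∞ ξ) (hu : ∀ s, ‖deriv ξ s‖ = 1) (s : ℝ) :
    inner ℝ (deriv ξ s) (deriv (deriv (deriv ξ)) s) = -curv ξ s ^ 2 := by
  have h := (hasDerivAt_of_smooth (smooth_deriv hs) s).inner ℝ
    (hasDerivAt_of_smooth (smooth_deriv (smooth_deriv hs)) s)
  have hc : (fun t => inner ℝ (deriv ξ t) (deriv (deriv ξ) t)) = fun _ => (0 : ℝ) :=
    funext fun t => inner_deriv_deriv hs hu t
  rw [hc] at h
  have := h.unique (hasDerivAt_const s (0 : ℝ))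
  rw [real_inner_self_eq_norm_sq] at this
  rw [curv]
  linarith

theorem norm_sub_le_sub (hs : ContDiff ℝ ∞ ξ) (hu : ∀ s, ‖deriv ξ s‖ = 1) {x y : ℝ}
    (hxy : x ≤ y) : ‖ξ x - ξ y‖ ≤ y - x := by
  have := Convex.norm_image_sub_le_of_norm_deriv_le (f := ξ) (C := 1) (s := univ) (x := x) (y := y)
    (fun s _ => (hasDerivAt_of_smooth hs s).differentiableAt) (fun s _ => (hu s).le) convex_univ
    trivial trivial
  rwa [one_mul, Real.norm_of_nonneg (sub_nonneg.2 hxy), norm_sub_rev] at this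

/-- One-sided Taylor estimate, by integrating the bound on the fourth derivative four times. Applied
to `G₀` and `-G₀` it gives both sides of the chord expansion. -/
theorem chord_sq_aux {G₀ G₁ G₂ G₃ G₄ : ℝ → ℝ} {η c : ℝ}
    (h₀ : ∀ t, HasDerivAt G₀ (G₁ t) t) (h₁ : ∀ t, HasDerivAt G₁ (G₂ t) t)
    (h₂ : ∀ t, HasDerivAt G₂ (G₃ t) t) (h₃ : ∀ t, HasDerivAt G₃ (G₄ t) t)
    (z₀ : G₀ 0 = 0) (z₁ : G₁ 0 = 0) (z₂ : G₂ 0 = 0) (z₃ : G₃ 0 = 0)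
    (hG : ∀ t ∈ Icc 0 η, G₄ t ≤ c) : ∀ t ∈ Icc 0 η, G₀ t ≤ c / 24 * t ^ 4 := by
  have a₃ : ∀ t ∈ Icc 0 η, G₃ t - c * t ≤ 0 :=
    nonpos_of_hasDerivAt_nonpos (f' := fun t => G₄ t - c)
      (fun t => by simpa using (h₃ t).fun_sub ((hasDerivAt_id t).const_mul c)) (by simp [z₃])
      fun t ht => by linarith [hG t ht]
  have a₂ : ∀ t ∈ Icc 0 η, G₂ t - c / 2 * t ^ 2 ≤ 0 :=
    nonpos_of_hasDerivAt_nonpos (f' := fun t => G₃ t - c / 2 * (2 * t))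
      (fun t => by simpa using (h₂ t).fun_sub ((hasDerivAt_pow 2 t).const_mul (c / 2))) (by simp [z₂])
      fun t ht => by linarith [a₃ t ht]
  have a₁ : ∀ t ∈ Icc 0 η, G₁ t - c / 6 * t ^ 3 ≤ 0 :=
    nonpos_of_hasDerivAt_nonpos (f' := fun t => G₂ t - c / 6 * (3 * t ^ 2))
      (fun t => by simpa using (h₁ t).fun_sub ((hasDerivAt_pow 3 t).const_mul (c / 6))) (by simp [z₁])
      fun t ht => by linarith [a₂ t ht]
  have a₀ : ∀ t ∈ Icc 0 η, G₀ t - c / 24 * t ^ 4 ≤ 0 :=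
    nonpos_of_hasDerivAt_nonpos (f' := fun t => G₁ t - c / 24 * (4 * t ^ 3))
      (fun t => by simpa using (h₀ t).fun_sub ((hasDerivAt_pow 4 t).const_mul (c / 24))) (by simp [z₀])
      fun t ht => by linarith [a₁ t ht]
  intro t ht
  linarith [a₀ t ht]

/-- Expansion of the squared length of a short chord. -/
theorem exists_chord_sq (hs : ContDiff ℝ ∞ ξ) (hu : ∀ s, ‖deriv ξ s‖ = 1)
    (hp : Function.Periodic ξ ℓ) (hℓ : 0 < ℓ) {ε : ℝ} (hε : 0 < ε) :
    ∃ η > 0, ∀ x t, 0 ≤ t → t ≤ η →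
      |‖ξ x - ξ (x + t)‖ ^ 2 - t ^ 2 + curv ξ x ^ 2 / 12 * t ^ 4| ≤ ε / 12 * t ^ 4 := by
  have s1 := smooth_deriv hs
  have s2 := smooth_deriv s1
  have s3 := smooth_deriv s2
  have s4 := smooth_deriv s3
  obtain ⟨B, hB0, hB⟩ := exists_bound_of_periodic
    (periodic_deriv (periodic_deriv (periodic_deriv (periodic_deriv hp)))) hℓ.ne' s4.continuous
  obtain ⟨η₁, hη₁, h1⟩ := exists_uniform_of_periodic (f := fun s => curv ξ s ^ 2)
    (fun x => by simp only [periodic_curv hp x]) hℓ ((continuous_curv hs).pow 2)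
    (half_pos hε)
  refine ⟨min η₁ (ε / (2 * B)), by positivity, fun x t ht0 ht => ?_⟩
  set η := min η₁ (ε / (2 * B)) with hη
  have d0 : ∀ r, HasDerivAt (fun r => ξ (x + r) - ξ x) (deriv ξ (x + r)) r := fun r =>
    ((hasDerivAt_of_smooth hs (x + r)).comp_const_add x r).sub_const _
  have d1 : ∀ r, HasDerivAt (fun r => deriv ξ (x + r)) (deriv (deriv ξ) (x + r)) r := fun r =>
    (hasDerivAt_of_smooth s1 (x + r)).comp_const_add x r
  have d2 : ∀ r, HasDerivAt (fun r => deriv (deriv ξ) (x + r)) (deriv (deriv (deriv ξ)) (x + r)) r :=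
    fun r => (hasDerivAt_of_smooth s2 (x + r)).comp_const_add x r
  have d3 : ∀ r, HasDerivAt (fun r => deriv (deriv (deriv ξ)) (x + r))
      (deriv (deriv (deriv (deriv ξ))) (x + r)) r :=
    fun r => (hasDerivAt_of_smooth s3 (x + r)).comp_const_add x r
  set v : ℝ → E := fun r => ξ (x + r) - ξ x with hv
  -- the derivatives of `‖v‖² - t²`
  have e0 : ∀ r, HasDerivAt (fun r => inner ℝ (v r) (v r) - r ^ 2)
      (2 * inner ℝ (v r) (deriv ξ (x + r)) - 2 * r) r := fun r => by
    have := ((d0 r).inner ℝ (d0 r)).sub (hasDerivAt_pow 2 r)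
    refine this.congr_deriv ?_
    simp only [hv, Nat.cast_ofNat]
    rw [real_inner_comm (ξ (x + r) - ξ x) (deriv ξ (x + r))]; ring
  have e1 : ∀ r, HasDerivAt (fun r => 2 * inner ℝ (v r) (deriv ξ (x + r)) - 2 * r)
      (2 * inner ℝ (v r) (deriv (deriv ξ) (x + r))) r := fun r => by
    have := (((d0 r).inner ℝ (d1 r)).const_mul 2).sub ((hasDerivAt_id r).const_mul 2)
    refine this.congr_deriv ?_
    rw [real_inner_self_eq_norm_sq, hu]; simp only [hv]; ring
  have e2 : ∀ r, HasDerivAt (fun r => 2 * inner ℝ (v r) (deriv (deriv ξ) (x + r)))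
      (2 * inner ℝ (v r) (deriv (deriv (deriv ξ)) (x + r))) r := fun r => by
    have := ((d0 r).inner ℝ (d2 r)).const_mul 2
    refine this.congr_deriv ?_
    rw [inner_deriv_deriv hs hu]; simp only [hv]; ring
  have e3 : ∀ r, HasDerivAt (fun r => 2 * inner ℝ (v r) (deriv (deriv (deriv ξ)) (x + r)))
      (2 * inner ℝ (v r) (deriv (deriv (deriv (deriv ξ))) (x + r)) - 2 * curv ξ (x + r) ^ 2) r :=
    fun r => by
    have := ((d0 r).inner ℝ (d3 r)).const_mul 2
    refine this.congr_deriv ?_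
    rw [inner_deriv_deriv₃ hs hu]; simp only [hv]; ring
  have v0 : v 0 = 0 := by simp [hv]
  have hb : ∀ r ∈ Icc 0 η, |(2 * inner ℝ (v r) (deriv (deriv (deriv (deriv ξ))) (x + r)) -
      2 * curv ξ (x + r) ^ 2) + 2 * curv ξ x ^ 2| ≤ 2 * ε := by
    intro r hr
    have b1 := h1 x r hr.1 (hr.2.trans (min_le_left _ _))
    have b2 : ‖v r‖ ≤ r := by
      have := norm_sub_le_sub hs hu (show x ≤ x + r by linarith [hr.1])
      rw [norm_sub_rev] at this
      linarith
    have b3 := (abs_real_inner_le_norm (v r) (deriv (deriv (deriv (deriv ξ))) (x + r))).trans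
      (mul_le_mul b2 (hB (x + r)) (norm_nonneg _) hr.1)
    have b4 : r * B ≤ ε / 2 := by
      have := (le_div_iff₀ (by positivity)).1 (hr.2.trans (min_le_right _ _))
      linarith
    rw [abs_le] at b1 b3 ⊢
    constructor <;> linarith [b1.1, b1.2, b3.1, b3.2]
  have up := chord_sq_aux e0 e1 e2 e3 (by simp [v0]) (by simp [v0]) (by simp [v0]) (by simp [v0])
    (c := 2 * ε - 2 * curv ξ x ^ 2) (η := η)
    (fun r hr => by have := (abs_le.1 (hb r hr)).2; linarith) t ⟨ht0, ht⟩
  have low := chord_sq_aux (fun r => (e0 r).neg) (fun r => (e1 r).neg) (fun r => (e2 r).neg)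
    (fun r => (e3 r).neg) (by simp [v0]) (by simp [v0]) (by simp [v0]) (by simp [v0])
    (c := 2 * ε + 2 * curv ξ x ^ 2) (η := η)
    (fun r hr => by have := (abs_le.1 (hb r hr)).1; linarith) t ⟨ht0, ht⟩
  have hn : inner ℝ (v t) (v t) = ‖ξ x - ξ (x + t)‖ ^ 2 := by
    rw [real_inner_self_eq_norm_sq, norm_sub_rev]
  simp only [Pi.neg_apply] at low
  rw [hn] at up low
  rw [abs_le]
  constructor <;> linarith

/-- The defect of a short chord is, up to a small error, the cube of its affine length. -/
theorem exists_chord_defect (hs : ContDiff ℝ ∞ ξ) (hu : ∀ s, ‖deriv ξ s‖ = 1)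
    (hp : Function.Periodic ξ ℓ) (hℓ : 0 < ℓ) {τ : ℝ} (hτ : 0 < τ) :
    ∃ η > 0, ∀ x t, 0 ≤ t → t ≤ η →
      24 * (t - ‖ξ x - ξ (x + t)‖) ≤ (t * (affDens ξ x + τ)) ^ 3 ∧
      (t * max (affDens ξ x - τ) 0) ^ 3 ≤ 24 * (t - ‖ξ x - ξ (x + t)‖) := by
  -- Changing the density by `τ` changes its cube by at least `τ ^ 3`. Half of this pays for the
  -- error in the squared chord, the other half for the term `a ^ 2 * t ^ 6` that appears on
  -- squaring `t - a * t ^ 3`.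
  obtain ⟨η₁, hη₁, h1⟩ := exists_chord_sq hs hu hp hℓ (ε := τ ^ 3 / 2) (by positivity)
  obtain ⟨B, hB0, hB⟩ := exists_bound_of_periodic (periodic_affDens hp) hℓ.ne'
    (continuous_affDens hs)
  set M : ℝ := (B + τ) ^ 3 / 24 with hM
  have hM0 : 0 < M := by positivity
  refine ⟨min η₁ (min 1 (τ ^ 3 / (24 * M ^ 2))), by positivity, fun x t ht0 ht => ?_⟩
  have t1 : t ≤ η₁ := ht.trans (min_le_left _ _)
  have t2 : t ≤ 1 := ht.trans ((min_le_right _ _).trans (min_le_left _ _))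
  have t3 : t * (24 * M ^ 2) ≤ τ ^ 3 :=
    (le_div_iff₀ (by positivity)).1 (ht.trans ((min_le_right _ _).trans (min_le_right _ _)))
  obtain ⟨k1, k2⟩ := abs_le.1 (h1 x t ht0 t1)
  have hκ := affDens_nonneg (ξ := ξ) x
  have hκB : affDens ξ x ≤ B := (le_abs_self _).trans (hB x)
  rw [← affDens_pow] at k1 k2
  set κ := affDens ξ x
  set h := ‖ξ x - ξ (x + t)‖
  have h0 : 0 ≤ h := norm_nonneg _
  have hle : h ≤ t := by
    have := norm_sub_le_sub hs hu (show x ≤ x + t by linarith)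
    simpa using this
  constructor
  · by_contra! hcon
    set a := (κ + τ) ^ 3 / 24 with ha
    have ha0 : 0 ≤ a := by positivity
    have haM : a ≤ M := by rw [ha, hM]; gcongr
    have hh : h < t - a * t ^ 3 := by
      have : (t * (κ + τ)) ^ 3 = 24 * (a * t ^ 3) := by rw [ha]; ring
      linarith
    have hsq : h ^ 2 < (t - a * t ^ 3) ^ 2 := by gcongr
    have c1 : κ ^ 3 + τ ^ 3 ≤ 24 * a := by
      rw [ha]
      have : 0 ≤ 3 * κ ^ 2 * τ + 3 * κ * τ ^ 2 := by positivity
      nlinarith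
    have c2 : a ^ 2 * t ^ 6 ≤ τ ^ 3 / 24 * t ^ 4 := by
      have : a ^ 2 * t ^ 2 ≤ τ ^ 3 / 24 := by
        calc a ^ 2 * t ^ 2 ≤ M ^ 2 * (t * 1) := by
              rw [sq t]; gcongr
          _ ≤ τ ^ 3 / 24 := by linarith
      calc a ^ 2 * t ^ 6 = (a ^ 2 * t ^ 2) * t ^ 4 := by ring
        _ ≤ _ := by gcongr
    have c3 : (κ ^ 3 + τ ^ 3) * t ^ 4 ≤ 24 * a * t ^ 4 := by gcongr
    nlinarith
  · rcases ht0.eq_or_lt with rfl | htpos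
    · have : h = 0 := le_antisymm hle h0
      simp [this]
    -- The curvature may vanish at some points, so `κ - τ` can be negative; the lower bound is then
    -- trivial.
    rcases le_total κ τ with hc | hc
    · rw [max_eq_right (by linarith)]
      simp only [mul_zero, ne_eq, OfNat.ofNat_ne_zero, not_false_eq_true, zero_pow]
      linarith
    · rw [max_eq_left (by linarith)]
      have c1 : (κ - τ) ^ 3 ≤ κ ^ 3 - τ ^ 3 / 2 := by
        obtain ⟨d, hd⟩ : ∃ d, κ = d + τ := ⟨κ - τ, by ring⟩
        have hd0 : 0 ≤ d := by linarith
        rw [hd, add_sub_cancel_right]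
        have : 0 ≤ 3 * d ^ 2 * τ + 3 * d * τ ^ 2 + τ ^ 3 / 2 := by positivity
        nlinarith
      have c2 : (κ - τ) ^ 3 * t ^ 4 ≤ (κ ^ 3 - τ ^ 3 / 2) * t ^ 4 := by gcongr
      have c3 : (κ - τ) ^ 3 * t ^ 4 ≤ 12 * (t ^ 2 - h ^ 2) := by linarith
      have c4 : 12 * (t ^ 2 - h ^ 2) ≤ 24 * (t - h) * t := by nlinarith
      have c5 : (t * (κ - τ)) ^ 3 * t ≤ 24 * (t - h) * t := by
        calc (t * (κ - τ)) ^ 3 * t = (κ - τ) ^ 3 * t ^ 4 := by ring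
          _ ≤ _ := c3.trans c4
      exact le_of_mul_le_mul_right c5 htpos

end

end Billiard

/-! ### Asymptotics of the maximal perimeter of inscribed polygons -/

namespace Billiard

section

variable {E : Type*} [NormedAddCommGroup E] [InnerProductSpace ℝ E] {ξ : ℝ → E} {ℓ : ℝ}

omit [InnerProductSpace ℝ E] in
theorem sub_chainLength_eq {q : ℕ} {x : ℕ → ℝ} (hx : IsClosedChain ℓ 1 q x) :
    ℓ - chainLength (fun x y => ‖ξ x - ξ y‖) q x =
      ∑ i ∈ Finset.range q, (x (i + 1) - x i - ‖ξ (x i) - ξ (x (i + 1))‖) := by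
  rw [Finset.sum_sub_distrib, Finset.sum_range_sub, hx.finish, chainLength]
  simp

/-- Polygons whose sides have equal affine lengths. -/
theorem sub_maxLength_le (hs : ContDiff ℝ ∞ ξ) (hu : ∀ s, ‖deriv ξ s‖ = 1)
    (hp : Function.Periodic ξ ℓ) (hH : IsChordLength ℓ fun x y => ‖ξ x - ξ y‖) {τ : ℝ}
    (hτ : 0 < τ) : ∀ᶠ n : ℕ in atTop,
      (n : ℝ) ^ 2 * (ℓ - maxLength ℓ (fun x y => ‖ξ x - ξ y‖) 1 n) ≤
        ((∫ s in 0..ℓ, affDens ξ s) + 2 * τ * ℓ) ^ 3 / 24 := by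
  have hℓ := hH.pos
  have hcont := continuous_affDens hs
  obtain ⟨η₁, hη₁, h1⟩ := exists_chord_defect hs hu hp hℓ hτ
  obtain ⟨η₂, hη₂, h2⟩ := exists_uniform_of_periodic (periodic_affDens hp) hℓ hcont hτ
  -- One `τ` of the `2 * τ` is the loss in the chord estimate, the other the variation of the
  -- density along a short arc. Positivity of `w` also makes its primitive strictly increasing and,
  -- for large `n`, forces arcs of `w`-mass `Λ / n` to be short even where the curvature vanishes.
  set w : ℝ → ℝ := fun s => affDens ξ s + 2 * τ with hw
  have hwc : Continuous w := hcont.add_const _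
  have hwi : ∀ a b, IntervalIntegrable w MeasureTheory.volume a b :=
    fun a b => hwc.intervalIntegrable a b
  have hw2 : ∀ s, 2 * τ ≤ w s := fun s => by simp only [hw]; linarith [affDens_nonneg (ξ := ξ) s]
  set Φ : ℝ → ℝ := fun s => ∫ r in 0..s, w r with hΦ
  have hΦd : ∀ s, HasDerivAt Φ (w s) s := fun s => (hwc.integral_hasStrictDerivAt 0 s).hasDerivAt
  have hΦm : StrictMono Φ := strictMono_of_hasDerivAt_pos hΦd fun s => by linarith [hw2 s]
  have hΦc : Continuous Φ := continuous_iff_continuousAt.2 fun s => (hΦd s).continuousAt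
  have hΦ0 : Φ 0 = 0 := by simp [hΦ]
  set Λ : ℝ := Φ ℓ with hΛ
  have hΛe : (∫ s in 0..ℓ, affDens ξ s) + 2 * τ * ℓ = Λ := by
    simp only [hΛ, hΦ, hw]
    rw [intervalIntegral.integral_add (hcont.intervalIntegrable _ _) intervalIntegrable_const]
    simp; ring
  have hΛ0 : 0 < Λ := by rw [← hΦ0]; exact hΦm hℓ
  rw [hΛe]
  set η := min η₁ η₂ with hη
  have hη0 : 0 < η := by positivity
  obtain ⟨N, hN⟩ := exists_nat_ge (Λ / (2 * τ * η))
  filter_upwards [eventually_ge_atTop (N + 1)] with n hn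
  have hn0 : (0 : ℝ) < n := by exact_mod_cast (Nat.succ_pos N).trans_le hn
  have hnN : Λ / n ≤ 2 * τ * η := by
    rw [div_le_iff₀ hn0]
    have : (N : ℝ) ≤ n := by exact_mod_cast (Nat.le_succ N).trans hn
    have := (div_le_iff₀ (by positivity)).1 (hN.trans this)
    linarith
  have hex : ∀ i : ℕ, ∃ x, i ≤ n → x ∈ Icc 0 ℓ ∧ Φ x = i * (Λ / n) := by
    intro i
    by_cases hi : i ≤ n
    · have hi' : (i : ℝ) ≤ n := by exact_mod_cast hi
      have : (i : ℝ) * (Λ / n) ∈ Icc (Φ 0) (Φ ℓ) := by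
        rw [hΦ0, ← hΛ]
        refine ⟨by positivity, ?_⟩
        rw [mul_div_assoc', div_le_iff₀ hn0]
        nlinarith
      obtain ⟨x, hx, hx'⟩ := intermediate_value_Icc hℓ.le hΦc.continuousOn this
      exact ⟨x, fun _ => ⟨hx, hx'⟩⟩
    · exact ⟨0, fun h => absurd h hi⟩
  choose x hx using hex
  have hx0 : x 0 = 0 := hΦm.injective (by rw [(hx 0 (Nat.zero_le _)).2, hΦ0]; simp)
  have hxn : x n = ℓ := hΦm.injective (by
    rw [(hx n le_rfl).2, ← hΛ]; field_simp)
  have hdiff : ∀ i < n, Φ (x (i + 1)) - Φ (x i) = Λ / n := fun i hi => by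
    rw [(hx (i + 1) hi).2, (hx i hi.le).2]; push_cast; ring
  have hmono : ∀ i < n, x i ≤ x (i + 1) := fun i hi => by
    rw [← hΦm.le_iff_le]
    have := hdiff i hi
    have : 0 ≤ Λ / n := by positivity
    linarith
  have hchain : IsClosedChain ℓ 1 n x := by
    refine ⟨by simp [hx0, hxn], fun i hi => ⟨hmono i hi, ?_⟩⟩
    linarith [(hx (i + 1) hi).1.2, (hx i hi.le).1.1]
  have hstep : ∀ i ∈ Finset.range n,
      x (i + 1) - x i - ‖ξ (x i) - ξ (x (i + 1))‖ ≤ (Λ / n) ^ 3 / 24 := by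
    intro i hi
    rw [Finset.mem_range] at hi
    have hle := hmono i hi
    have hint : Φ (x (i + 1)) - Φ (x i) = ∫ s in x i..x (i + 1), w s :=
      intervalIntegral.integral_interval_sub_left (hwi _ _) (hwi _ _)
    rw [hdiff i hi] at hint
    have hlow : ∀ c : ℝ, (∀ s ∈ Icc (x i) (x (i + 1)), c ≤ w s) →
        (x (i + 1) - x i) * c ≤ Λ / n := by
      intro c hc
      rw [hint, ← smul_eq_mul, ← intervalIntegral.integral_const]
      exact intervalIntegral.integral_mono_on hle intervalIntegrable_const (hwi _ _) hc
    have hsmall : x (i + 1) - x i ≤ η := by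
      have := (hlow (2 * τ) fun s _ => hw2 s).trans hnN
      rw [mul_comm] at this
      exact le_of_mul_le_mul_left this (by positivity)
    have hc := (h1 (x i) (x (i + 1) - x i) (by linarith) (hsmall.trans (min_le_left _ _))).1
    rw [add_sub_cancel] at hc
    have hl := hlow (affDens ξ (x i) + τ) fun s hs => by
      have := (abs_le.1 (h2 (x i) (s - x i) (by linarith [hs.1])
        (by linarith [hs.2, min_le_right η₁ η₂]))).1
      rw [add_sub_cancel] at this
      simp only [hw]; linarith
    have h3 : ((x (i + 1) - x i) * (affDens ξ (x i) + τ)) ^ 3 ≤ (Λ / n) ^ 3 := by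
      refine pow_le_pow_left₀ (mul_nonneg (by linarith) ?_) hl 3
      linarith [affDens_nonneg (ξ := ξ) (x i)]
    linarith
  have htot := Finset.sum_le_sum hstep
  rw [← sub_chainLength_eq hchain, Finset.sum_const, Finset.card_range, nsmul_eq_mul] at htot
  have hF := hH.chainLength_le_maxLength hchain
  calc (n : ℝ) ^ 2 * (ℓ - maxLength ℓ (fun x y => ‖ξ x - ξ y‖) 1 n)
      ≤ (n : ℝ) ^ 2 * (n * ((Λ / n) ^ 3 / 24)) := by
        gcongr
        linarith
    _ = Λ ^ 3 / 24 := by field_simp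

/-- Lower bound for the defect of an arc that is a union of `m` short arcs. -/
theorem le_chord_defect {τ η a : ℝ} (hs : ContDiff ℝ ∞ ξ) (ha : 0 ≤ a)
    (h1 : ∀ x t, 0 ≤ t → t ≤ η →
      (t * max (affDens ξ x - τ) 0) ^ 3 ≤ 24 * (t - ‖ξ x - ξ (x + t)‖))
    (h2 : ∀ x t, 0 ≤ t → t ≤ η → |affDens ξ (x + t) - affDens ξ x| ≤ τ) (hη : 0 < η) (m : ℕ) :
    ∀ x t, 0 ≤ t → t ≤ (m + 1) * η →
      3 * a ^ 2 * ((∫ s in x..x + t, affDens ξ s) - 2 * τ * t) - 2 * a ^ 3 * (m + 1) ≤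
        24 * (t - ‖ξ x - ξ (x + t)‖) := by
  have hint : ∀ a b, IntervalIntegrable (affDens ξ) MeasureTheory.volume a b :=
    fun a b => (continuous_affDens hs).intervalIntegrable a b
  have short : ∀ x t, 0 ≤ t → t ≤ η →
      3 * a ^ 2 * ((∫ s in x..x + t, affDens ξ s) - 2 * τ * t) - 2 * a ^ 3 ≤
        24 * (t - ‖ξ x - ξ (x + t)‖) := by
    intro x t ht0 ht
    have hI : (∫ s in x..x + t, affDens ξ s) ≤ t * (affDens ξ x + τ) := by
      have : (∫ s in x..x + t, affDens ξ s) ≤ ∫ s in x..x + t, (affDens ξ x + τ) := by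
        refine intervalIntegral.integral_mono_on (by linarith) (hint _ _)
          intervalIntegrable_const fun s hs => ?_
        have := (abs_le.1 (h2 x (s - x) (by linarith [hs.1]) (by linarith [hs.2]))).2
        rw [add_sub_cancel] at this
        linarith
      simpa [mul_add] using this
    have h3 : (∫ s in x..x + t, affDens ξ s) - 2 * τ * t ≤ t * max (affDens ξ x - τ) 0 := by
      have : t * (affDens ξ x - τ) ≤ t * max (affDens ξ x - τ) 0 :=
        mul_le_mul_of_nonneg_left (le_max_left _ _) ht0
      linarith
    have h4 : 0 ≤ t * max (affDens ξ x - τ) 0 := mul_nonneg ht0 (le_max_right _ _)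
    have h5 := h1 x t ht0 ht
    set u := t * max (affDens ξ x - τ) 0
    have h6 : 3 * a ^ 2 * ((∫ s in x..x + t, affDens ξ s) - 2 * τ * t) ≤ 3 * a ^ 2 * u := by
      gcongr
    -- This is `3 a² u - 2 a³ ≤ u³`: the cube lies above its tangent at `a`. The minorant is affine
    -- in `u`, so it can be summed over pieces of an arc.
    have h7 : 0 ≤ (u - a) ^ 2 * (u + 2 * a) := by positivity
    nlinarith
  induction m with
  | zero =>
    intro x t ht0 ht
    have := short x t ht0 (by simpa using ht)
    simpa using this
  | succ m ih =>
    intro x t ht0 ht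
    push_cast at ht ⊢
    rcases le_total t η with h | h
    · have := short x t ht0 h
      have : 0 ≤ 2 * a ^ 3 * ((m : ℝ) + 1) := by positivity
      linarith
    · have k1 := short x η hη.le le_rfl
      have k2 := ih (x + η) (t - η) (by linarith) (by linarith)
      rw [show x + η + (t - η) = x + t by ring] at k2
      have k3 := intervalIntegral.integral_add_adjacent_intervals (hint x (x + η))
        (hint (x + η) (x + t))
      -- By the triangle inequality, subdividing an arc can only lower the total defect.
      have k4 := norm_sub_le_norm_sub_add_norm_sub (ξ x) (ξ (x + η)) (ξ (x + t))
      rw [← k3]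
      linarith

/-- Arbitrary polygons may have long sides. Cutting these into arcs of length at most `η` takes at
most `n + ℓ / η` arcs in all, and the `ℓ / η` extra tangent-line constants cost only `C / n`. The
tangent is taken at the mean value `a = Λ / n`. -/
theorem le_sub_maxLength (hs : ContDiff ℝ ∞ ξ) (hu : ∀ s, ‖deriv ξ s‖ = 1)
    (hp : Function.Periodic ξ ℓ) (hH : IsChordLength ℓ fun x y => ‖ξ x - ξ y‖) {τ : ℝ}
    (hτ : 0 < τ) (hL : 0 ≤ (∫ s in 0..ℓ, affDens ξ s) - 2 * τ * ℓ) :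
    ∃ C : ℝ, ∀ n : ℕ, 0 < n →
      ((∫ s in 0..ℓ, affDens ξ s) - 2 * τ * ℓ) ^ 3 / 24 - C / n ≤
        (n : ℝ) ^ 2 * (ℓ - maxLength ℓ (fun x y => ‖ξ x - ξ y‖) 1 n) := by
  have hℓ := hH.pos
  have hcont := continuous_affDens hs
  obtain ⟨η₁, hη₁, h1⟩ := exists_chord_defect hs hu hp hℓ hτ
  obtain ⟨η₂, hη₂, h2⟩ := exists_uniform_of_periodic (periodic_affDens hp) hℓ hcont hτ
  set η := min η₁ η₂ with hη
  have hη0 : 0 < η := by positivity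
  set Λ : ℝ := (∫ s in 0..ℓ, affDens ξ s) - 2 * τ * ℓ with hΛ
  refine ⟨Λ ^ 3 * ℓ / (12 * η), fun n hn => ?_⟩
  have hn0 : (0 : ℝ) < n := by exact_mod_cast hn
  set a := Λ / n with ha
  have ha0 : 0 ≤ a := by positivity
  have hkey : maxLength ℓ (fun x y => ‖ξ x - ξ y‖) 1 n ≤
      ℓ - (3 * a ^ 2 * Λ - 2 * a ^ 3 * (n + ℓ / η)) / 24 := by
    refine hH.maxLength_le hn fun x hx => ?_
    have hstep : ∀ i ∈ Finset.range n,
        3 * a ^ 2 * ((∫ s in x i..x (i + 1), affDens ξ s) - 2 * τ * (x (i + 1) - x i)) -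
          2 * a ^ 3 * (1 + (x (i + 1) - x i) / η) ≤
        24 * (x (i + 1) - x i - ‖ξ (x i) - ξ (x (i + 1))‖) := by
      intro i hi
      have hle := (hx.step i (Finset.mem_range.1 hi)).1
      have hd : 0 ≤ (x (i + 1) - x i) / η := div_nonneg (by linarith) hη0.le
      have hm1 := Nat.floor_le hd
      have hm2 := Nat.lt_floor_add_one ((x (i + 1) - x i) / η)
      have := le_chord_defect hs ha0
        (fun x t h0 h => (h1 x t h0 (h.trans (min_le_left _ _))).2)
        (fun x t h0 h => h2 x t h0 (h.trans (min_le_right _ _))) hη0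
        ⌊(x (i + 1) - x i) / η⌋₊ (x i) (x (i + 1) - x i) (by linarith)
        ((div_le_iff₀ hη0).1 hm2.le)
      rw [add_sub_cancel] at this
      have h3 : 2 * a ^ 3 * ((⌊(x (i + 1) - x i) / η⌋₊ : ℝ) + 1) ≤
          2 * a ^ 3 * (1 + (x (i + 1) - x i) / η) := by
        exact mul_le_mul_of_nonneg_left (by linarith) (by positivity)
      linarith
    have hsum := Finset.sum_le_sum hstep
    rw [← Finset.mul_sum, ← sub_chainLength_eq hx, Finset.sum_sub_distrib, ← Finset.mul_sum,
      ← Finset.mul_sum, Finset.sum_sub_distrib, Finset.sum_add_distrib, ← Finset.mul_sum,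
      ← Finset.sum_div, Finset.sum_range_sub, intervalIntegral.sum_integral_adjacent_intervals
        (fun _ _ => hcont.intervalIntegrable _ _), hx.finish, Nat.cast_one, one_mul,
      (periodic_affDens hp).intervalIntegral_add_eq (x 0) 0, zero_add, add_sub_cancel_left] at hsum
    simp only [Finset.sum_const, Finset.card_range, nsmul_eq_mul, mul_one] at hsum
    rw [← hΛ] at hsum
    linarith
  have : (n : ℝ) ^ 2 * ((3 * a ^ 2 * Λ - 2 * a ^ 3 * (n + ℓ / η)) / 24) =
      Λ ^ 3 / 24 - Λ ^ 3 * ℓ / (12 * η) / n := by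
    rw [ha]; field_simp; ring
  rw [← this]
  gcongr
  linarith

/-- The asymptotics of the maximal perimeter of inscribed `n`-gons. -/
theorem tendsto_sub_maxLength (hs : ContDiff ℝ ∞ ξ) (hu : ∀ s, ‖deriv ξ s‖ = 1)
    (hp : Function.Periodic ξ ℓ) (hH : IsChordLength ℓ fun x y => ‖ξ x - ξ y‖) :
    Tendsto (fun n : ℕ => (n : ℝ) ^ 2 * (ℓ - maxLength ℓ (fun x y => ‖ξ x - ξ y‖) 1 n)) atTop
      (𝓝 ((∫ s in 0..ℓ, affDens ξ s) ^ 3 / 24)) := by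
  set L := ∫ s in 0..ℓ, affDens ξ s with hL
  have hlim : ∀ c : ℝ, Tendsto (fun τ : ℝ => (L + c * τ * ℓ) ^ 3 / 24) (𝓝[>] 0)
      (𝓝 (L ^ 3 / 24)) := by
    intro c
    have : ContinuousAt (fun τ : ℝ => (L + c * τ * ℓ) ^ 3 / 24) 0 := by fun_prop
    have := this.tendsto
    simp only [mul_zero, zero_mul, add_zero] at this
    exact this.mono_left nhdsWithin_le_nhds
  refine tendsto_order.2 ⟨fun b hb => ?_, fun b hb => ?_⟩
  -- The lower estimate needs `L - 2 * τ * ℓ ≥ 0`, which fails if `L = 0`; negative `b` is settled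
  -- by `maxLength ≤ ℓ`, and for `b ≥ 0` the sign follows from the choice of `τ`.
  · rcases lt_or_ge b 0 with hb0 | hb0
    · filter_upwards [eventually_gt_atTop 0] with n hn
      have := hH.maxLength_le_mul (p := 1) (q := n) hn
      simp only [Nat.cast_one, one_mul] at this
      exact hb0.trans_le (mul_nonneg (by positivity) (by linarith))
    · obtain ⟨τ, hτb, hτ⟩ := (((hlim (-2)).eventually (lt_mem_nhds hb)).and
        self_mem_nhdsWithin).exists
      have hpos : 0 ≤ L - 2 * τ * ℓ := by
        by_contra! h
        have : (L + -2 * τ * ℓ) ^ 3 < 0 := Odd.pow_neg (by decide) (by linarith)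
        linarith
      obtain ⟨C, hC⟩ := le_sub_maxLength hs hu hp hH hτ hpos
      have ht : Tendsto (fun n : ℕ => (L - 2 * τ * ℓ) ^ 3 / 24 - C / n) atTop
          (𝓝 ((L - 2 * τ * ℓ) ^ 3 / 24 - 0)) :=
        tendsto_const_nhds.sub (tendsto_const_div_atTop_nhds_zero_nat C)
      rw [sub_zero] at ht
      have hb' : b < (L - 2 * τ * ℓ) ^ 3 / 24 := by
        rwa [show L - 2 * τ * ℓ = L + -2 * τ * ℓ by ring]
      filter_upwards [ht.eventually (lt_mem_nhds hb'), eventually_gt_atTop 0] with n h1 h2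
      exact h1.trans_le (hC n h2)
  · obtain ⟨τ, hτb, hτ⟩ := (((hlim 2).eventually (gt_mem_nhds hb)).and self_mem_nhdsWithin).exists
    filter_upwards [sub_maxLength_le hs hu hp hH hτ] with n hn
    exact hn.trans_lt hτb

end

end Billiard

namespace Billiard

/-! ### Coordinates in the plane -/

/-- The determinant of two vectors of the plane. -/
def cross (u v : Plane) : ℝ := u 0 * v 1 - u 1 * v 0

theorem norm_sq_coord (u : Plane) : ‖u‖ ^ 2 = u 0 ^ 2 + u 1 ^ 2 := by
  rw [EuclideanSpace.real_norm_sq_eq, Fin.sum_univ_two]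

theorem inner_coord (u v : Plane) : inner ℝ u v = u 0 * v 0 + u 1 * v 1 := by
  rw [PiLp.inner_apply, Fin.sum_univ_two]
  simp [mul_comm]

theorem hasDerivAt_coord {f : ℝ → Plane} {f' : Plane} {s : ℝ} (h : HasDerivAt f f' s) (i : Fin 2) :
    HasDerivAt (fun t => f t i) (f' i) s :=
  (EuclideanSpace.proj (𝕜 := ℝ) i).hasFDerivAt.comp_hasDerivAt s h

theorem continuous_coord {f : ℝ → Plane} (h : Continuous f) (i : Fin 2) :
    Continuous fun t => f t i :=
  (EuclideanSpace.proj (𝕜 := ℝ) i).continuous.comp h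

/-! ### Support lines -/

/-- A closed curve, parametrized by arc length, with `σ` its orientation, that lies strictly on one
side of each of its tangent lines, apart from the point of contact. -/
structure IsConvexCurve (ℓ σ : ℝ) (ξ : ℝ → Plane) : Prop where
  pos : 0 < ℓ
  orientation : σ ^ 2 = 1
  smooth : ContDiff ℝ ∞ ξ
  unitSpeed : ∀ s, ‖deriv ξ s‖ = 1
  periodic : Function.Periodic ξ ℓ
  ne : ∀ s t, s < t → t < s + ℓ → ξ t ≠ ξ s
  support : ∀ s t, ξ t ≠ ξ s → 0 < σ * cross (deriv ξ s) (ξ t - ξ s)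

section

variable {Ω : Set Plane} {ℓ : ℝ} {ξ : ℝ → Plane}

theorem IsArcLengthBoundary.mem_frontier (hξ : IsArcLengthBoundary Ω ℓ ξ) (s : ℝ) :
    ξ s ∈ frontier Ω := hξ.range_eq ▸ mem_range_self s

theorem IsArcLengthBoundary.ne_of_lt (hξ : IsArcLengthBoundary Ω ℓ ξ) {s t : ℝ} (h1 : s < t)
    (h2 : t < s + ℓ) : ξ t ≠ ξ s := by
  intro h
  have hp := hξ.pos
  have key : ∀ r, ξ (toIcoMod hp 0 r) = ξ r := fun r => by
    rw [toIcoMod]; exact hξ.periodic.sub_zsmul_eq _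
  have h3 : toIcoMod hp 0 s = toIcoMod hp 0 t := by
    have m : ∀ r, toIcoMod hp 0 r ∈ Ico 0 ℓ := fun r => by
      have := toIcoMod_mem_Ico hp 0 r
      rwa [zero_add] at this
    exact hξ.injOn (m s) (m t) (by rw [key, key, h])
  obtain ⟨n, hn⟩ := toIcoMod_eq_toIcoMod hp |>.1 h3
  rw [zsmul_eq_mul] at hn
  have h4 : (0 : ℝ) < n := by
    by_contra! hle
    nlinarith
  have h5 : (n : ℝ) < 1 := by
    by_contra! hle
    nlinarith
  have h6 : 0 < n := by exact_mod_cast h4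
  have h7 : n < 1 := by exact_mod_cast h5
  omega

/-- A functional separating `ξ s` from `Ω` is minimal along the curve at `s`, so it kills the
tangent and is a multiple of the determinant with it. -/
theorem exists_support (hΩ : IsStrictlyConvexDomain Ω) (hξ : IsArcLengthBoundary Ω ℓ ξ) (s : ℝ) :
    ∃ μ : ℝ, ∀ z ∈ Ω, 0 < μ * cross (deriv ξ s) (z - ξ s) := by
  have hfr : ∀ t, ξ t ∉ Ω := fun t ht => by
    have := hξ.mem_frontier t
    rw [hΩ.isOpen.frontier_eq] at this
    exact this.2 ht
  obtain ⟨f, hf⟩ := geometric_hahn_banach_point_open hΩ.convex hΩ.isOpen (hfr s)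
  have hcl : ∀ z ∈ closure Ω, f (ξ s) ≤ f z := fun z hz =>
    closure_minimal (fun y hy => (hf y hy).le) (isClosed_le continuous_const f.continuous) hz
  have hd : HasDerivAt (fun t => f (ξ t)) (f (deriv ξ s)) s :=
    f.hasFDerivAt.comp_hasDerivAt s (hasDerivAt_of_smooth hξ.smooth s)
  have hmin : IsLocalMin (fun t => f (ξ t)) s :=
    Eventually.of_forall fun t => hcl _ (frontier_subset_closure (hξ.mem_frontier t))
  have h0 := hmin.hasDerivAt_eq_zero hd
  set e₀ : Plane := EuclideanSpace.single 0 1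
  set e₁ : Plane := EuclideanSpace.single 1 1
  have hdec : ∀ v : Plane, f v = v 0 * f e₀ + v 1 * f e₁ := fun v => by
    have : v = v 0 • e₀ + v 1 • e₁ := by
      ext i; fin_cases i <;> simp [e₀, e₁]
    conv_lhs => rw [this]
    simp
  have hT := norm_sq_coord (deriv ξ s)
  rw [hξ.unitSpeed, one_pow] at hT
  rw [hdec] at h0
  refine ⟨deriv ξ s 0 * f e₁ - deriv ξ s 1 * f e₀, fun z hz => ?_⟩
  have h1 : 0 < f (z - ξ s) := by rw [map_sub]; linarith [hf z hz]
  rw [hdec] at h1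
  refine h1.trans_eq ?_
  rw [cross]
  set T := deriv ξ s
  set v := z - ξ s
  have a0 : f e₀ = -(T 0 * f e₁ - T 1 * f e₀) * T 1 := by
    linear_combination (f e₀) * hT + T 0 * h0
  have a1 : f e₁ = (T 0 * f e₁ - T 1 * f e₀) * T 0 := by
    linear_combination (f e₁) * hT + T 1 * h0
  linear_combination v 0 * a0 + v 1 * a1

/-- The side of the tangent on which a fixed interior point lies depends continuously on `s` and
never degenerates, so one sign serves all tangents. Strictness on the boundary comes from the
midpoint of a chord, which is interior. -/
theorem exists_isConvexCurve (hΩ : IsStrictlyConvexDomain Ω) (hξ : IsArcLengthBoundary Ω ℓ ξ) :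
    ∃ σ, IsConvexCurve ℓ σ ξ := by
  obtain ⟨z₀, hz₀⟩ := hΩ.nonempty
  have hs1 := smooth_deriv hξ.smooth
  have hcont : Continuous fun s => cross (deriv ξ s) (z₀ - ξ s) := by
    have h1 : Continuous fun s => z₀ - ξ s := continuous_const.sub hξ.smooth.continuous
    exact ((continuous_coord hs1.continuous 0).mul (continuous_coord h1 1)).sub
      ((continuous_coord hs1.continuous 1).mul (continuous_coord h1 0))
  have hne : ∀ s, cross (deriv ξ s) (z₀ - ξ s) ≠ 0 := fun s h => by
    obtain ⟨μ, hμ⟩ := exists_support hΩ hξ s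
    have := hμ z₀ hz₀
    rw [h, mul_zero] at this
    exact lt_irrefl _ this
  obtain ⟨σ, hσ, hσ'⟩ : ∃ σ : ℝ, σ ^ 2 = 1 ∧ ∀ s, 0 < σ * cross (deriv ξ s) (z₀ - ξ s) := by
    by_cases h : ∃ s, cross (deriv ξ s) (z₀ - ξ s) ≤ 0
    · refine ⟨-1, by norm_num, fun s => ?_⟩
      by_contra! hcon
      obtain ⟨r, hr⟩ := mem_range_of_exists_le_of_exists_ge hcont h ⟨s, by linarith⟩
      exact hne r hr
    · push Not at h
      exact ⟨1, by norm_num, fun s => by rw [one_mul]; exact h s⟩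
  have hall : ∀ s, ∀ z ∈ Ω, 0 < σ * cross (deriv ξ s) (z - ξ s) := fun s z hz => by
    obtain ⟨μ, hμ⟩ := exists_support hΩ hξ s
    have h1 := mul_pos (hμ z hz) (hμ z₀ hz₀)
    have h2 : 0 < cross (deriv ξ s) (z - ξ s) * cross (deriv ξ s) (z₀ - ξ s) := by
      have : 0 < μ ^ 2 * (cross (deriv ξ s) (z - ξ s) * cross (deriv ξ s) (z₀ - ξ s)) := by
        linarith
      by_contra! hle
      exact this.not_ge (mul_nonpos_of_nonneg_of_nonpos (sq_nonneg μ) hle)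
    have h3 : 0 < (σ * cross (deriv ξ s) (z - ξ s)) * (σ * cross (deriv ξ s) (z₀ - ξ s)) := by
      linear_combination h2 - (cross (deriv ξ s) (z - ξ s) * cross (deriv ξ s) (z₀ - ξ s)) * hσ
    exact (mul_pos_iff_of_pos_right (hσ' s)).1 h3
  refine ⟨σ, hξ.pos, hσ, hξ.smooth, hξ.unitSpeed, hξ.periodic, fun s t => hξ.ne_of_lt,
    fun s t hst => ?_⟩
  have hmid := hΩ.strictConvex (frontier_subset_closure (hξ.mem_frontier t))
    (frontier_subset_closure (hξ.mem_frontier s)) hst (a := 1 / 2) (b := 1 / 2)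
    (by norm_num) (by norm_num) (by norm_num)
  rw [hΩ.convex.interior_closure_eq_interior_of_nonempty_interior
    (by rw [hΩ.isOpen.interior_eq]; exact hΩ.nonempty), hΩ.isOpen.interior_eq] at hmid
  have h1 := hall s _ hmid
  have h2 : cross (deriv ξ s) ((1 / 2 : ℝ) • ξ t + (1 / 2 : ℝ) • ξ s - ξ s) =
      1 / 2 * cross (deriv ξ s) (ξ t - ξ s) := by
    simp only [cross, PiLp.sub_apply, PiLp.add_apply, PiLp.smul_apply, smul_eq_mul]; ring
  rw [h2] at h1
  linarith

end

/-! ### The quadrangle inequality -/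

/-- The diagonals of a convex quadrilateral intersect. -/
theorem norm_add_norm_le_of_quadrilateral {A B C D : Plane} {σ : ℝ}
    (h1 : 0 < σ * cross (B - A) (C - A)) (h2 : 0 < σ * cross (C - A) (D - A))
    (h3 : 0 < σ * cross (B - A) (D - A)) (h4 : 0 < σ * cross (C - B) (D - B)) :
    ‖A - D‖ + ‖B - C‖ ≤ ‖A - C‖ + ‖B - D‖ := by
  set p := σ * cross (B - A) (C - A) with hp
  set q := σ * cross (C - A) (D - A) with hq
  set r := σ * cross (B - A) (D - A) with hr
  set w := σ * cross (C - B) (D - B) with hw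
  -- Twice the area of the quadrilateral, split along either diagonal. The ratios of these areas
  -- locate the intersection point of the diagonals.
  have hS : p + q = r + w := by
    simp only [hp, hq, hr, hw, cross, PiLp.sub_apply]; ring
  have hS0 : 0 < p + q := by linarith
  have hS0' : 0 < r + w := by linarith
  have hP : A + (r / (p + q)) • (C - A) = B + (p / (p + q)) • (D - B) := by
    have e0 : (p + q) * A 0 + r * (C 0 - A 0) = (p + q) * B 0 + p * (D 0 - B 0) := by
      simp only [hp, hq, hr, cross, PiLp.sub_apply]; ring
    have e1 : (p + q) * A 1 + r * (C 1 - A 1) = (p + q) * B 1 + p * (D 1 - B 1) := by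
      simp only [hp, hq, hr, cross, PiLp.sub_apply]; ring
    ext i
    simp only [PiLp.add_apply, PiLp.smul_apply, PiLp.sub_apply, smul_eq_mul]
    fin_cases i
    · simp only [Fin.zero_eta]; field_simp; linarith
    · simp only [Fin.mk_one]; field_simp; linarith
  set t := r / (p + q) with ht
  set u := p / (p + q) with hu
  have ht0 : 0 ≤ t := by positivity
  have ht1 : t ≤ 1 := by rw [ht, div_le_one hS0]; linarith
  have hu0 : 0 ≤ u := by positivity
  have hu1 : u ≤ 1 := by rw [hu, div_le_one hS0]; linarith
  set P := A + t • (C - A) with hPdef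
  have n1 : ‖A - P‖ = t * ‖A - C‖ := by
    rw [show A - P = t • (A - C) by rw [hPdef]; module, norm_smul, Real.norm_of_nonneg ht0]
  have n2 : ‖P - C‖ = (1 - t) * ‖A - C‖ := by
    rw [show P - C = (1 - t) • (A - C) by rw [hPdef]; module, norm_smul,
      Real.norm_of_nonneg (by linarith)]
  have n3 : ‖B - P‖ = u * ‖B - D‖ := by
    rw [show B - P = u • (B - D) by rw [hP]; module, norm_smul, Real.norm_of_nonneg hu0]
  have n4 : ‖P - D‖ = (1 - u) * ‖B - D‖ := by
    rw [show P - D = (1 - u) • (B - D) by rw [hP]; module, norm_smul,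
      Real.norm_of_nonneg (by linarith)]
  have t1 := norm_sub_le_norm_sub_add_norm_sub A P D
  have t2 := norm_sub_le_norm_sub_add_norm_sub B P C
  rw [n1, n4] at t1
  rw [n3, n2] at t2
  linarith

namespace IsConvexCurve

variable {ℓ σ : ℝ} {ξ : ℝ → Plane} (hξ : IsConvexCurve ℓ σ ξ)
include hξ

theorem hasDerivAt (s : ℝ) : HasDerivAt ξ (deriv ξ s) s := hasDerivAt_of_smooth hξ.smooth s

theorem sq_add_sq (s : ℝ) : deriv ξ s 0 ^ 2 + deriv ξ s 1 ^ 2 = 1 := by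
  rw [← norm_sq_coord, hξ.unitSpeed, one_pow]

theorem support_of_lt {s t : ℝ} (h1 : s < t) (h2 : t < s + ℓ) :
    0 < σ * cross (deriv ξ s) (ξ t - ξ s) ∧ 0 < σ * cross (deriv ξ t) (ξ s - ξ t) :=
  ⟨hξ.support s t (hξ.ne s t h1 h2), hξ.support t s (hξ.ne s t h1 h2).symm⟩

/-- Three points in cyclic order span a positively oriented triangle. -/
theorem triangle_pos {a b c : ℝ} (hab : a < b) (hbc : b < c) (hca : c < a + ℓ) :
    0 < σ * cross (ξ b - ξ a) (ξ c - ξ a) := by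
  set T := deriv ξ a with hT
  set f : ℝ → ℝ := fun t => T 0 * (ξ t - ξ a) 0 + T 1 * (ξ t - ξ a) 1 with hf
  set g : ℝ → ℝ := fun t => σ * cross T (ξ t - ξ a) with hg
  have hgpos : ∀ t ∈ Ioo a (a + ℓ), 0 < g t := fun t ht => (hξ.support_of_lt ht.1 ht.2).1
  have hd : ∀ t i, HasDerivAt (fun t => (ξ t - ξ a) i) (deriv ξ t i) t := fun t i =>
    hasDerivAt_coord ((hξ.hasDerivAt t).sub_const (ξ a)) i
  have hfd : ∀ t, HasDerivAt f (T 0 * deriv ξ t 0 + T 1 * deriv ξ t 1) t := fun t =>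
    ((hd t 0).const_mul _).fun_add ((hd t 1).const_mul _)
  have hgd : ∀ t, HasDerivAt g (σ * cross T (deriv ξ t)) t := fun t =>
    (((hd t 1).const_mul _).fun_sub ((hd t 0).const_mul _)).const_mul σ
  -- `f / g` is the cotangent of the angle at `ξ a` between the tangent and the chord to `ξ t`. By
  -- the support inequality at `t` this angle increases.
  have hanti : StrictAntiOn (fun t => f t / g t) (Ioo a (a + ℓ)) := by
    refine strictAntiOn_of_deriv_neg (convex_Ioo _ _) (fun t ht => ?_) fun t ht => ?_
    · exact ((hfd t).continuousAt.div (hgd t).continuousAt (hgpos t ht).ne').continuousWithinAt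
    · rw [interior_Ioo] at ht
      have hg0 := hgpos t ht
      rw [((hfd t).fun_div (hgd t) hg0.ne').deriv]
      refine div_neg_of_neg_of_pos ?_ (by positivity)
      have h1 := (hξ.support_of_lt ht.1 ht.2).2
      have h2 := hξ.sq_add_sq a
      have h3 : (T 0 * deriv ξ t 0 + T 1 * deriv ξ t 1) * g t - f t * (σ * cross T (deriv ξ t)) =
          -(σ * cross (deriv ξ t) (ξ a - ξ t)) * (T 0 ^ 2 + T 1 ^ 2) := by
        simp only [hf, hg, cross, PiLp.sub_apply]; ring
      rw [h3, hT, h2]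
      linarith
  have hb : b ∈ Ioo a (a + ℓ) := ⟨hab, hbc.trans hca⟩
  have hc : c ∈ Ioo a (a + ℓ) := ⟨hab.trans hbc, hca⟩
  have h := hanti hb hc hbc
  simp only at h
  rw [div_lt_div_iff₀ (hgpos c hc) (hgpos b hb)] at h
  have h2 := hξ.sq_add_sq a
  have h3 : f b * g c - f c * g b = σ * cross (ξ b - ξ a) (ξ c - ξ a) * (T 0 ^ 2 + T 1 ^ 2) := by
    simp only [hf, hg, cross, PiLp.sub_apply]; ring
  rw [hT, h2, mul_one] at h3
  linarith

theorem isChordLength : IsChordLength ℓ fun x y => ‖ξ x - ξ y‖ where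
  pos := hξ.pos
  nonneg _ _ := norm_nonneg _
  self _ := by simp
  turn x := by simp [hξ.periodic x]
  shift x y := by simp only [hξ.periodic x, hξ.periodic y]
  le_sub x y h := norm_sub_le_sub hξ.smooth hξ.unitSpeed h
  quadrangle x x' y y' h1 h2 h3 h4 := by
    rcases h1.eq_or_lt with rfl | h1
    · exact (add_comm _ _).le
    rcases h3.eq_or_lt with rfl | h3
    · exact le_rfl
    rcases h2.eq_or_lt with rfl | h2
    · simpa using norm_sub_le_norm_sub_add_norm_sub (ξ x) (ξ x') (ξ y')
    rcases h4.eq_or_lt with rfl | h4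
    · rw [hξ.periodic x, sub_self, norm_zero, zero_add, add_comm]
      exact norm_sub_le_norm_sub_add_norm_sub (ξ x') (ξ x) (ξ y)
    exact norm_add_norm_le_of_quadrilateral (hξ.triangle_pos h1 h2 (h3.trans h4))
      (hξ.triangle_pos (h1.trans h2) h3 h4) (hξ.triangle_pos h1 (h2.trans h3) h4)
      (hξ.triangle_pos h2 h3 (by linarith))

/-! ### The total curvature -/

theorem deriv_deriv_coord (s : ℝ) :
    deriv (deriv ξ) s 0 = -cross (deriv ξ s) (deriv (deriv ξ) s) * deriv ξ s 1 ∧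
    deriv (deriv ξ) s 1 = cross (deriv ξ s) (deriv (deriv ξ) s) * deriv ξ s 0 := by
  have h1 := inner_deriv_deriv hξ.smooth hξ.unitSpeed s
  have h2 := hξ.sq_add_sq s
  rw [inner_coord] at h1
  rw [cross]
  constructor
  · linear_combination (-deriv (deriv ξ) s 0) * h2 + deriv ξ s 0 * h1
  · linear_combination (-deriv (deriv ξ) s 1) * h2 + deriv ξ s 1 * h1

/-- The support inequalities at `s` and at `t` add up to a sign for the determinant of the
increments of `ξ` and `deriv ξ`; divide by `(t - s) ^ 2` and let `t → s`. -/
theorem curvature_nonneg (s : ℝ) : 0 ≤ σ * cross (deriv ξ s) (deriv (deriv ξ) s) := by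
  have d1 := hξ.hasDerivAt s
  have d2 := hasDerivAt_of_smooth (smooth_deriv hξ.smooth) s
  have sl : ∀ {f : ℝ → Plane} {f' : Plane}, HasDerivAt f f' s → ∀ i,
      Tendsto (fun t => (t - s)⁻¹ * (f t i - f s i)) (𝓝[≠] s) (𝓝 (f' i)) := fun h i => by
    have := (hasDerivAt_iff_tendsto_slope.1 (hasDerivAt_coord h i))
    simpa only [slope_fun_def, vsub_eq_sub, smul_eq_mul] using this
  have hlim := (((sl d1 0).mul (sl d2 1)).sub ((sl d1 1).mul (sl d2 0))).const_mul σ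
  refine ge_of_tendsto hlim ?_
  filter_upwards [self_mem_nhdsWithin] with t ht
  have h0 : 0 ≤ σ * cross (deriv ξ s) (ξ t - ξ s) + σ * cross (deriv ξ t) (ξ s - ξ t) := by
    by_cases h : ξ t = ξ s
    · simp [h, cross]
    · exact add_nonneg (hξ.support s t h).le (hξ.support t s (Ne.symm h)).le
  have h1 : σ * ((t - s)⁻¹ * (ξ t 0 - ξ s 0) * ((t - s)⁻¹ * (deriv ξ t 1 - deriv ξ s 1)) -
      (t - s)⁻¹ * (ξ t 1 - ξ s 1) * ((t - s)⁻¹ * (deriv ξ t 0 - deriv ξ s 0))) =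
      ((t - s)⁻¹) ^ 2 *
        (σ * cross (deriv ξ s) (ξ t - ξ s) + σ * cross (deriv ξ t) (ξ s - ξ t)) := by
    simp only [cross, PiLp.sub_apply]; ring
  rw [h1]
  exact mul_nonneg (sq_nonneg _) h0

theorem curv_eq (s : ℝ) : curv ξ s = σ * cross (deriv ξ s) (deriv (deriv ξ) s) := by
  obtain ⟨h0, h1⟩ := hξ.deriv_deriv_coord s
  have h2 := hξ.sq_add_sq s
  refine (pow_left_inj₀ (norm_nonneg _) (hξ.curvature_nonneg s) two_ne_zero).1 ?_
  rw [norm_sq_coord, h0, h1, mul_pow σ, hξ.orientation]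
  linear_combination (cross (deriv ξ s) (deriv (deriv ξ) s)) ^ 2 * h2

/-- The tangent vector turns with speed the curvature. -/
theorem tangent_eq (s : ℝ) :
    deriv ξ s 0 * Real.cos (∫ r in 0..s, curv ξ r) +
      σ * deriv ξ s 1 * Real.sin (∫ r in 0..s, curv ξ r) = deriv ξ 0 0 ∧
    deriv ξ s 1 * Real.cos (∫ r in 0..s, curv ξ r) -
      σ * deriv ξ s 0 * Real.sin (∫ r in 0..s, curv ξ r) = deriv ξ 0 1 := by
  set θ : ℝ → ℝ := fun s => ∫ r in 0..s, curv ξ r with hθ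
  have hθd : ∀ s, HasDerivAt θ (curv ξ s) s := fun s =>
    ((continuous_curv hξ.smooth).integral_hasStrictDerivAt 0 s).hasDerivAt
  have hT : ∀ s i, HasDerivAt (fun s => deriv ξ s i) (deriv (deriv ξ) s i) s := fun s i =>
    hasDerivAt_coord (hasDerivAt_of_smooth (smooth_deriv hξ.smooth) s) i
  have hσ := hξ.orientation
  have c0 : ∀ s, HasDerivAt
      (fun s => deriv ξ s 0 * Real.cos (θ s) + σ * deriv ξ s 1 * Real.sin (θ s)) 0 s := fun s => by
    refine (((hT s 0).fun_mul (hθd s).cos).fun_add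
      (((hT s 1).const_mul σ).fun_mul (hθd s).sin)).congr_deriv ?_
    obtain ⟨h0, h1⟩ := hξ.deriv_deriv_coord s
    rw [h0, h1, hξ.curv_eq]
    linear_combination (cross (deriv ξ s) (deriv (deriv ξ) s) * deriv ξ s 1 * Real.cos (θ s)) * hσ
  have c1 : ∀ s, HasDerivAt
      (fun s => deriv ξ s 1 * Real.cos (θ s) - σ * deriv ξ s 0 * Real.sin (θ s)) 0 s := fun s => by
    refine (((hT s 1).fun_mul (hθd s).cos).fun_sub
      (((hT s 0).const_mul σ).fun_mul (hθd s).sin)).congr_deriv ?_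
    obtain ⟨h0, h1⟩ := hξ.deriv_deriv_coord s
    rw [h0, h1, hξ.curv_eq]
    linear_combination
      (-cross (deriv ξ s) (deriv (deriv ξ) s) * deriv ξ s 0 * Real.cos (θ s)) * hσ
  have e0 := is_const_of_deriv_eq_zero (fun s => (c0 s).differentiableAt) (fun s => (c0 s).deriv) s 0
  have e1 := is_const_of_deriv_eq_zero (fun s => (c1 s).differentiableAt) (fun s => (c1 s).deriv) s 0
  have z : θ 0 = 0 := by simp [hθ]
  simp only [z, Real.cos_zero, Real.sin_zero, mul_one, mul_zero, add_zero, sub_zero] at e0 e1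
  exact ⟨e0, e1⟩

/-- The tangent direction is not repeated within one turn. -/
theorem cos_ne_one {s : ℝ} (h0 : 0 < s) (h1 : s < ℓ) :
    Real.cos (∫ r in 0..s, curv ξ r) ≠ 1 := by
  intro hc
  have hs : Real.sin (∫ r in 0..s, curv ξ r) = 0 := Real.sin_eq_zero_iff_cos_eq.2 (Or.inl hc)
  obtain ⟨e0, e1⟩ := hξ.tangent_eq s
  rw [hc, hs] at e0 e1
  obtain ⟨a, b⟩ := hξ.support_of_lt h0 (by simpa using h1)
  simp only [cross, PiLp.sub_apply, ← e0, ← e1] at a b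
  -- Equal tangents at `0` and `s` would put each point strictly on the positive side of the other's
  -- parallel tangent line.
  linarith

/-- The turning angle is nondecreasing and its total is a multiple of `2 π`, since the tangent
closes up. If the total were `0`, the angle would vanish at `ℓ / 2`; if it were at least `4 π`, it
would equal `2 π` at some interior point. Both repeat a tangent within one turn. -/
theorem integral_curv : ∫ s in 0..ℓ, curv ξ s = 2 * Real.pi := by
  have hℓ := hξ.pos
  have hπ := Real.pi_pos
  have hc := continuous_curv hξ.smooth
  have hint : ∀ a b, IntervalIntegrable (curv ξ) MeasureTheory.volume a b :=
    fun a b => hc.intervalIntegrable a b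
  set θ : ℝ → ℝ := fun s => ∫ r in 0..s, curv ξ r with hθ
  have hθc : Continuous θ := intervalIntegral.continuous_primitive hint 0
  have hθ0 : θ 0 = 0 := by simp [hθ]
  have hmono : ∀ s t, s ≤ t → θ s ≤ θ t := fun s t hst => by
    have h1 : θ t - θ s = ∫ r in s..t, curv ξ r :=
      intervalIntegral.integral_interval_sub_left (hint _ _) (hint _ _)
    have h2 : 0 ≤ ∫ r in s..t, curv ξ r :=
      intervalIntegral.integral_nonneg hst fun r _ => norm_nonneg _
    linarith
  change θ ℓ = 2 * Real.pi
  have hcos : Real.cos (θ ℓ) = 1 := by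
    obtain ⟨e0, e1⟩ := hξ.tangent_eq ℓ
    have hper : deriv ξ ℓ = deriv ξ 0 := by simpa using periodic_deriv hξ.periodic 0
    rw [hper] at e0 e1
    linear_combination deriv ξ 0 0 * e0 + deriv ξ 0 1 * e1 +
      (1 - Real.cos (θ ℓ)) * hξ.sq_add_sq 0
  obtain ⟨n, hn⟩ := (Real.cos_eq_one_iff _).1 hcos
  have hpos : 0 ≤ θ ℓ := hθ0 ▸ hmono 0 ℓ hℓ.le
  have hn0 : 0 ≤ n := by
    by_contra! h
    have : (n : ℝ) < 0 := by exact_mod_cast h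
    nlinarith
  have hn1 : n ≠ 0 := by
    rintro rfl
    rw [Int.cast_zero, zero_mul] at hn
    have h1 := hmono 0 (ℓ / 2) (by linarith)
    have h2 := hmono (ℓ / 2) ℓ (by linarith)
    have h3 : θ (ℓ / 2) = 0 := by linarith
    exact hξ.cos_ne_one (half_pos hℓ) (by linarith) (by
      change Real.cos (θ (ℓ / 2)) = 1
      rw [h3, Real.cos_zero])
  have hn2 : n < 2 := by
    by_contra! h
    have h' : (2 : ℝ) ≤ n := by exact_mod_cast h
    have hmem : 2 * Real.pi ∈ Icc (θ 0) (θ ℓ) := by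
      rw [hθ0]; constructor
      · positivity
      · nlinarith
    obtain ⟨s, hs, hs'⟩ := intermediate_value_Icc hℓ.le hθc.continuousOn hmem
    have s0 : s ≠ 0 := by rintro rfl; rw [hθ0] at hs'; linarith
    have s1 : s ≠ ℓ := by rintro rfl; nlinarith
    exact hξ.cos_ne_one (lt_of_le_of_ne hs.1 s0.symm) (lt_of_le_of_ne hs.2 s1) (by
      change Real.cos (θ s) = 1
      rw [hs', Real.cos_two_pi])
  have : n = 1 := by omega
  rw [← hn, this, Int.cast_one, one_mul]

end IsConvexCurve

end Billiard

namespace Billiard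

/-! ### The isoperimetric inequality for the affine length -/

section

variable {ℓ σ : ℝ} {ξ : ℝ → Plane}

theorem IsConvexCurve.affine_isoperimetric (hξ : IsConvexCurve ℓ σ ξ) :
    (∫ s in 0..ℓ, affDens ξ s) ^ 3 ≤ 4 * Real.pi ^ 2 * ℓ ∧
    ((∫ s in 0..ℓ, affDens ξ s) ^ 3 = 4 * Real.pi ^ 2 * ℓ ↔ ∀ s, curv ξ s = 2 * Real.pi / ℓ) := by
  have hℓ := hξ.pos
  have hπ := Real.pi_pos
  set L := ∫ s in 0..ℓ, affDens ξ s with hL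
  set m : ℝ → ℝ := fun s => curv ξ s ^ (1 / 3 : ℝ) with hm
  have hmc : Continuous m := continuous_rpow_third hξ.smooth
  have hm0 : ∀ s, 0 ≤ m s := fun s => Real.rpow_nonneg (norm_nonneg _) _
  have hm3 : ∀ s, m s ^ 3 = curv ξ s := fun s => rpow_third_pow s
  set c : ℝ := (2 * Real.pi / ℓ) ^ (1 / 3 : ℝ) with hc
  have hc0 : 0 < c := by positivity
  have hc3 : c ^ 3 = 2 * Real.pi / ℓ := by
    rw [hc, ← Real.rpow_natCast, ← Real.rpow_mul (by positivity)]; norm_num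
  -- Hölder's inequality with its equality case: `F = 2 m³ - 3 c m² + c³ ≥ 0` vanishes only where `m
  -- = c`. With `c ^ 3` the mean curvature, its integral is `6 π - 3 c L`.
  set F : ℝ → ℝ := fun s => (m s - c) ^ 2 * (2 * m s + c) with hF
  have hFc : Continuous F := by fun_prop
  have hF0 : ∀ s, 0 ≤ F s := fun s => mul_nonneg (sq_nonneg _) (by linarith [hm0 s])
  have hint : ∫ s in 0..ℓ, F s = 6 * Real.pi - 3 * c * L := by
    have e : F = fun s => 2 * curv ξ s - 3 * c * affDens ξ s + c ^ 3 := by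
      funext s
      have h1 : affDens ξ s = m s ^ 2 := rfl
      simp only [hF]
      rw [← hm3, h1]; ring
    have i1 : IntervalIntegrable (fun s => 2 * curv ξ s) MeasureTheory.volume 0 ℓ :=
      ((continuous_curv hξ.smooth).const_mul 2).intervalIntegrable _ _
    have i2 : IntervalIntegrable (fun s => 3 * c * affDens ξ s) MeasureTheory.volume 0 ℓ :=
      ((continuous_affDens hξ.smooth).const_mul (3 * c)).intervalIntegrable _ _
    rw [e, intervalIntegral.integral_add (i1.sub i2) intervalIntegrable_const,
      intervalIntegral.integral_sub i1 i2, intervalIntegral.integral_const_mul,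
      intervalIntegral.integral_const_mul, hξ.integral_curv, intervalIntegral.integral_const, hc3,
      smul_eq_mul, ← hL]
    field_simp; ring
  have hL0 : 0 ≤ L := intervalIntegral.integral_nonneg hℓ.le fun s _ => affDens_nonneg s
  have hnn : 0 ≤ ∫ s in 0..ℓ, F s := intervalIntegral.integral_nonneg hℓ.le fun s _ => hF0 s
  have hcube : 4 * Real.pi ^ 2 * ℓ * c ^ 3 = (2 * Real.pi) ^ 3 := by
    rw [hc3]; field_simp; ring
  have hc3pos : 0 < c ^ 3 := by positivity
  refine ⟨?_, fun h => ?_, fun h => ?_⟩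
  · refine le_of_mul_le_mul_right ?_ hc3pos
    rw [hcube, ← mul_pow]
    exact pow_le_pow_left₀ (by positivity) (by linarith) 3
  · have h1 : (L * c) ^ 3 = (2 * Real.pi) ^ 3 := by rw [mul_pow, h, hcube]
    have h2 : L * c = 2 * Real.pi :=
      (pow_left_inj₀ (by positivity) (by positivity) three_ne_zero).1 h1
    have h3 : ∫ s in 0..ℓ, F s = 0 := by rw [hint]; linarith
    have h4 : ∀ s ∈ Icc 0 ℓ, m s = c := by
      intro s hs
      by_contra hne
      have hpos : 0 < F s := mul_pos (by have := sub_ne_zero.2 hne; positivity)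
        (by linarith [hm0 s])
      exact (intervalIntegral.integral_pos hℓ hFc.continuousOn (fun r _ => hF0 r)
        ⟨s, hs, hpos⟩).ne' h3
    intro s
    obtain ⟨r, hr, hr'⟩ := (periodic_curv hξ.periodic).exists_mem_Ico₀ hℓ s
    rw [hr', ← hm3, h4 r ⟨hr.1, hr.2.le⟩, hc3]
  · have h1 : L = ℓ * c ^ 2 := by
      have : affDens ξ = fun _ => c ^ 2 := by
        funext s; rw [affDens, h s]
      rw [hL, this]; simp
    refine mul_right_cancel₀ hc3pos.ne' ?_
    rw [hcube, h1, show (ℓ * c ^ 2) ^ 3 * c ^ 3 = ℓ ^ 3 * (c ^ 3) ^ 3 by ring, hc3]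
    field_simp

/-! ### Curves of constant curvature -/

theorem IsConvexCurve.curv_eq_of_mem_sphere (hξ : IsConvexCurve ℓ σ ξ) {c : Plane} {r : ℝ}
    (hr : 0 < r) (h : ∀ s, ‖ξ s - c‖ = r) (s : ℝ) : curv ξ s = 2 * Real.pi / ℓ := by
  have hℓ := hξ.pos
  have d1 : ∀ s, HasDerivAt (fun s => ξ s - c) (deriv ξ s) s := fun s =>
    (hξ.hasDerivAt s).sub_const c
  have e1 : ∀ s, inner ℝ (ξ s - c) (deriv ξ s) = 0 := fun s => by
    have h1 := (d1 s).norm_sq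
    have h2 : (‖ξ · - c‖ ^ 2 : ℝ → ℝ) = fun _ => r ^ 2 := by funext t; simp [h]
    rw [h2] at h1
    have := h1.unique (hasDerivAt_const s (r ^ 2))
    linarith
  have e2 : ∀ s, inner ℝ (ξ s - c) (deriv (deriv ξ) s) = -1 := fun s => by
    have h1 := (d1 s).inner ℝ (hasDerivAt_of_smooth (smooth_deriv hξ.smooth) s)
    have h2 : (fun t => inner ℝ (ξ t - c) (deriv ξ t)) = fun _ => (0 : ℝ) := funext e1
    rw [h2] at h1
    have := h1.unique (hasDerivAt_const s (0 : ℝ))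
    rw [real_inner_self_eq_norm_sq, hξ.unitSpeed] at this
    linarith
  have hk : ∀ s, curv ξ s = 1 / r := fun s => by
    refine (pow_left_inj₀ (show 0 ≤ curv ξ s from norm_nonneg _) (by positivity) two_ne_zero).1 ?_
    obtain ⟨c0, c1⟩ := hξ.deriv_deriv_coord s
    have h1 := e1 s
    have h2 := e2 s
    have h3 := h s
    have h4 := hξ.sq_add_sq s
    have h5 := norm_sq_coord (ξ s - c)
    rw [inner_coord] at h1 h2
    rw [h3] at h5
    rw [c0, c1] at h2
    rw [hξ.curv_eq, mul_pow, hξ.orientation, one_mul, div_pow, one_pow, eq_div_iff (by positivity)]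
    set k := cross (deriv ξ s) (deriv (deriv ξ) s)
    set u := ξ s - c
    set T := deriv ξ s
    have h6 : r ^ 2 = (T 0 * u 1 - T 1 * u 0) ^ 2 := by
      linear_combination h5 - (u 0 ^ 2 + u 1 ^ 2) * h4 + (u 0 * T 0 + u 1 * T 1) * h1
    have h7 : k * (T 0 * u 1 - T 1 * u 0) = -1 := by linear_combination h2
    rw [h6, ← mul_pow, h7]; norm_num
  have hI := hξ.integral_curv
  rw [show curv ξ = fun _ => 1 / r from funext hk, intervalIntegral.integral_const, sub_zero,
    smul_eq_mul] at hI
  rw [hk, eq_div_iff hℓ.ne', mul_comm, hI]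

/-- The center of curvature has derivative zero when the curvature is constant. -/
theorem IsConvexCurve.exists_center (hξ : IsConvexCurve ℓ σ ξ) {K : ℝ} (hK : 0 < K)
    (h : ∀ s, curv ξ s = K) : ∃ c : Plane, ∀ s, ‖ξ s - c‖ = 1 / K := by
  have hσ := hξ.orientation
  have hk : ∀ s, cross (deriv ξ s) (deriv (deriv ξ) s) = σ * K := fun s => by
    have := hξ.curv_eq s
    rw [h s] at this
    rw [this]
    linear_combination (-cross (deriv ξ s) (deriv (deriv ξ) s)) * hσ
  have hT : ∀ s i, HasDerivAt (fun s => deriv ξ s i) (deriv (deriv ξ) s i) s := fun s i =>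
    hasDerivAt_coord (hasDerivAt_of_smooth (smooth_deriv hξ.smooth) s) i
  have hX : ∀ s i, HasDerivAt (fun s => ξ s i) (deriv ξ s i) s := fun s i =>
    hasDerivAt_coord (hξ.hasDerivAt s) i
  have d0 : ∀ s, HasDerivAt (fun s => ξ s 0 - σ / K * deriv ξ s 1) 0 s := fun s => by
    refine ((hX s 0).fun_sub ((hT s 1).const_mul (σ / K))).congr_deriv ?_
    rw [(hξ.deriv_deriv_coord s).2, hk]
    field_simp
    linear_combination (-deriv ξ s 0) * hσ
  have d1 : ∀ s, HasDerivAt (fun s => ξ s 1 + σ / K * deriv ξ s 0) 0 s := fun s => by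
    refine ((hX s 1).fun_add ((hT s 0).const_mul (σ / K))).congr_deriv ?_
    rw [(hξ.deriv_deriv_coord s).1, hk]
    field_simp
    linear_combination (-deriv ξ s 1) * hσ
  refine ⟨!₂[ξ 0 0 - σ / K * deriv ξ 0 1, ξ 0 1 + σ / K * deriv ξ 0 0], fun s => ?_⟩
  have e0 := is_const_of_deriv_eq_zero (fun s => (d0 s).differentiableAt) (fun s => (d0 s).deriv) s 0
  have e1 := is_const_of_deriv_eq_zero (fun s => (d1 s).differentiableAt) (fun s => (d1 s).deriv) s 0
  simp only at e0 e1
  refine (pow_left_inj₀ (norm_nonneg _) (by positivity) two_ne_zero).1 ?_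
  rw [norm_sq_coord]
  simp only [PiLp.sub_apply, ← e0, ← e1, Matrix.cons_val_zero, Matrix.cons_val_one]
  have := hξ.sq_add_sq s
  field_simp
  linear_combination σ ^ 2 * this + hσ

end

/-- A point of the closure farthest from `c` cannot lie in the open set, hence is on the sphere, and
`Ω` is inside the ball. The ball is connected and misses the boundary, so `Ω` fills it. -/
theorem eq_ball_of_frontier_subset_sphere {E : Type*} [NormedAddCommGroup E] [NormedSpace ℝ E]
    [ProperSpace E] [Nontrivial E] {Ω : Set E} (ho : IsOpen Ω) (hne : Ω.Nonempty)
    (hb : Bornology.IsBounded Ω) {c : E} {r : ℝ} (hr : r ≠ 0)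
    (hfr : frontier Ω ⊆ Metric.sphere c r) : Ω = Metric.ball c r := by
  have hcont : Continuous fun y : E => ‖y - c‖ := by fun_prop
  obtain ⟨z, hz, hmax⟩ := hb.isCompact_closure.exists_isMaxOn hne.closure hcont.continuousOn
  have hzΩ : z ∉ Ω := by
    intro hzΩ
    obtain ⟨ε, hε, hball⟩ := Metric.isOpen_iff.1 ho z hzΩ
    obtain ⟨u, hu, hzu⟩ : ∃ u : E, ‖u‖ = 1 ∧ z - c = ‖z - c‖ • u := by
      by_cases h : z - c = 0
      · obtain ⟨v, hv⟩ := exists_norm_eq E zero_le_one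
        exact ⟨v, hv, by simp [h]⟩
      · have h' : ‖z - c‖ ≠ 0 := norm_ne_zero_iff.2 h
        exact ⟨‖z - c‖⁻¹ • (z - c), by simp [norm_smul, h'], by simp [smul_smul, h']⟩
    have hw : z + (ε / 2) • u ∈ Ω := hball (by
      rw [mem_ball_iff_norm, add_sub_cancel_left, norm_smul, hu, mul_one,
        Real.norm_of_nonneg (by positivity)]
      linarith)
    have h1 : ‖z + (ε / 2) • u - c‖ = ‖z - c‖ + ε / 2 := by
      rw [show z + (ε / 2) • u - c = (‖z - c‖ + ε / 2) • u by
        rw [add_smul, ← hzu]; abel, norm_smul, hu, mul_one, Real.norm_of_nonneg (by positivity)]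
    have h2 : ‖z + (ε / 2) • u - c‖ ≤ ‖z - c‖ := hmax (subset_closure hw)
    linarith
  have hzr : ‖z - c‖ = r := by
    rw [← mem_sphere_iff_norm]
    exact hfr (by rw [ho.frontier_eq]; exact ⟨hz, hzΩ⟩)
  have hle : Ω ⊆ Metric.closedBall c r := fun y hy => by
    rw [mem_closedBall_iff_norm, ← hzr]
    exact hmax (subset_closure hy)
  have hsub : Ω ⊆ Metric.ball c r := by
    rw [← interior_closedBall c hr]
    exact interior_maximal hle ho
  refine hsub.antisymm ?_
  refine Metric.isPreconnected_ball.subset_left_of_subset_union ho isClosed_closure.isOpen_compl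
    (disjoint_compl_right.mono_left subset_closure) (fun y hy => ?_) ?_
  · by_contra hcon
    rw [mem_union, not_or, notMem_compl_iff] at hcon
    have := hfr (by rw [ho.frontier_eq]; exact ⟨hcon.2, hcon.1⟩)
    rw [mem_sphere_iff_norm] at this
    rw [mem_ball_iff_norm] at hy
    linarith
  · obtain ⟨y, hy⟩ := hne
    exact ⟨y, hsub hy, hy⟩

section

variable {Ω : Set Plane} {ℓ σ : ℝ} {ξ : ℝ → Plane}

theorem isDisc_iff (hΩ : IsStrictlyConvexDomain Ω) (hξ : IsArcLengthBoundary Ω ℓ ξ)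
    (hc : IsConvexCurve ℓ σ ξ) : IsDisc Ω ↔ ∀ s, curv ξ s = 2 * Real.pi / ℓ := by
  have hπ := Real.pi_pos
  have hℓ := hξ.pos
  constructor
  · rintro ⟨c, r, hr, rfl⟩
    refine hc.curv_eq_of_mem_sphere (c := c) hr fun s => ?_
    have := hξ.mem_frontier s
    rwa [frontier_ball c hr.ne', mem_sphere_iff_norm] at this
  · intro h
    obtain ⟨c, h'⟩ := hc.exists_center (by positivity) h
    refine ⟨c, _, by positivity, eq_ball_of_frontier_subset_sphere hΩ.isOpen hΩ.nonempty
      hΩ.isBounded (r := 1 / (2 * Real.pi / ℓ)) (by positivity) ?_⟩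
    rw [← hξ.range_eq]
    rintro _ ⟨s, rfl⟩
    rw [mem_sphere_iff_norm, h']

end

/-! ### Taylor coefficients -/

theorem coeff_eq_zero_of_isLittleO (N : ℕ) (c : ℕ → ℝ)
    (h : (fun x : ℝ => ∑ n ∈ Finset.range (N + 1), c n * x ^ n) =o[𝓝[>] 0] fun x => x ^ N) :
    ∀ n ≤ N, c n = 0 := by
  induction N generalizing c with
  | zero =>
    intro n hn
    obtain rfl : n = 0 := by omega
    have h' : (fun _ : ℝ => c 0) =o[𝓝[>] 0] fun _ : ℝ => (1 : ℝ) := by simpa using h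
    rw [isLittleO_one_iff] at h'
    exact tendsto_nhds_unique tendsto_const_nhds h'
  | succ N ih =>
    have hcont : Tendsto (fun x : ℝ => ∑ n ∈ Finset.range (N + 1 + 1), c n * x ^ n) (𝓝[>] 0)
        (𝓝 (∑ n ∈ Finset.range (N + 1 + 1), c n * 0 ^ n)) := by
      have : Continuous fun x : ℝ => ∑ n ∈ Finset.range (N + 1 + 1), c n * x ^ n := by fun_prop
      exact (this.tendsto 0).mono_left nhdsWithin_le_nhds
    have hz : Tendsto (fun x : ℝ => x ^ (N + 1)) (𝓝[>] 0) (𝓝 0) := by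
      have : Continuous fun x : ℝ => x ^ (N + 1) := by fun_prop
      simpa using (this.tendsto 0).mono_left nhdsWithin_le_nhds
    have h0 := tendsto_nhds_unique hcont (h.trans_tendsto hz)
    rw [Finset.sum_range_succ'] at h0
    have hc0 : c 0 = 0 := by simpa using h0
    have hstep := ih (fun n => c (n + 1)) (by
      refine ((isBigO_refl (fun x : ℝ => x⁻¹) (𝓝[>] 0)).mul_isLittleO h).congr' ?_ ?_
      · filter_upwards [self_mem_nhdsWithin] with x hx
        have hx : x ≠ 0 := (mem_Ioi.1 hx).ne'
        rw [Finset.sum_range_succ', hc0, zero_mul, add_zero, Finset.mul_sum]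
        refine Finset.sum_congr rfl fun n _ => ?_
        field_simp
        ring
      · filter_upwards [self_mem_nhdsWithin] with x hx
        have hx : x ≠ 0 := (mem_Ioi.1 hx).ne'
        field_simp
        ring)
    intro n hn
    rcases n with _ | n
    · exact hc0
    · exact hstep n (by omega)

theorem HasTaylorCoeffs.unique {f : ℝ → ℝ} {N : ℕ} {b b' : ℕ → ℝ} (h : HasTaylorCoeffs f N b)
    (h' : HasTaylorCoeffs f N b') : ∀ n ≤ N, b n = b' n := by
  intro n hn
  have h1 := coeff_eq_zero_of_isLittleO N (fun n => (b n - b' n) / (n ! : ℝ)) (by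
    refine (h'.sub h).congr_left fun x => ?_
    rw [sub_sub_sub_cancel_left, ← Finset.sum_sub_distrib]
    exact Finset.sum_congr rfl fun n _ => by ring) n hn
  have h2 : (n ! : ℝ) ≠ 0 := by positivity
  rcases div_eq_zero_iff.1 h1 with h3 | h3
  · linarith
  · exact absurd h3 h2

/-! ### The expansion of the β-function at zero -/

section

variable {ℓ : ℝ} {ξ : ℝ → Plane}

/-- The third order expansion of the `β`-function at `0`. -/
theorem hasTaylorCoeffs_beta (hH : IsChordLength ℓ fun x y => ‖ξ x - ξ y‖) {c : ℝ}
    (hlim : Tendsto (fun n : ℕ => (n : ℝ) ^ 2 *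
      (ℓ - maxLength ℓ (fun x y => ‖ξ x - ξ y‖) 1 n)) atTop (𝓝 c)) :
    HasTaylorCoeffs (beta ξ ℓ) 3 (fun n => if n = 1 then -ℓ else if n = 3 then 6 * c else 0) := by
  set P : ℕ → ℝ := maxLength ℓ (fun x y => ‖ξ x - ξ y‖) 1 with hP
  have hfl : Tendsto (fun h : ℝ => ⌊h⁻¹⌋₊) (𝓝[>] 0) atTop :=
    tendsto_nat_floor_atTop.comp tendsto_inv_nhdsGT_zero
  have hquot : Tendsto (fun n : ℕ => (n : ℝ) / (n + 1)) atTop (𝓝 1) :=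
    tendsto_natCast_div_add_atTop (1 : ℝ)
  -- With `n = ⌊1 / h⌋`, replacing `1 / h ^ 2` by `n ^ 2` or `(n + 1) ^ 2` and shifting the index of
  -- `P` by one do not affect the limit.
  have low : Tendsto (fun n : ℕ => (n : ℝ) ^ 2 * (ℓ - P (n + 1))) atTop (𝓝 c) := by
    have := (hquot.pow 2).mul ((tendsto_add_atTop_iff_nat 1).2 hlim)
    rw [one_pow, one_mul] at this
    refine this.congr fun n => ?_
    push_cast
    field_simp
  have up : Tendsto (fun n : ℕ => ((n : ℝ) + 1) ^ 2 * (ℓ - P n)) atTop (𝓝 c) := by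
    have := ((hquot.inv₀ one_ne_zero).pow 2).mul hlim
    rw [inv_one, one_pow, one_mul] at this
    refine this.congr' ?_
    filter_upwards [eventually_gt_atTop 0] with n hn
    have : (n : ℝ) ≠ 0 := by positivity
    field_simp
  have hmain : Tendsto (fun h : ℝ => (beta ξ ℓ h + ℓ * h) / h ^ 3) (𝓝[>] 0) (𝓝 c) := by
    have hev : ∀ᶠ h : ℝ in 𝓝[>] 0,
        (⌊h⁻¹⌋₊ : ℝ) ^ 2 * (ℓ - P (⌊h⁻¹⌋₊ + 1)) ≤ (beta ξ ℓ h + ℓ * h) / h ^ 3 ∧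
        (beta ξ ℓ h + ℓ * h) / h ^ 3 ≤ ((⌊h⁻¹⌋₊ : ℝ) + 1) ^ 2 * (ℓ - P ⌊h⁻¹⌋₊) := by
      filter_upwards [self_mem_nhdsWithin, hfl.eventually (eventually_ge_atTop 2)] with h hh hn
      have hh : 0 < h := hh
      set n := ⌊h⁻¹⌋₊ with hn'
      have hn0 : (0 : ℝ) < n := by positivity
      have h1 : (n : ℝ) ≤ h⁻¹ := Nat.floor_le (by positivity)
      have h2 : h⁻¹ < n + 1 := Nat.lt_floor_add_one _
      have b1 : 1 / ((n : ℝ) + 1) ≤ h := by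
        rw [one_div]; exact inv_le_of_inv_le₀ hh h2.le
      have b2 : h ≤ 1 / n := by
        rw [one_div]; exact (le_inv_comm₀ hn0 hh).1 h1
      obtain ⟨k1, k2⟩ := beta_mem_Icc hH hn b1 b2
      have hPn : ∀ n : ℕ, 0 < n → 0 ≤ ℓ - P n := fun n hn => by
        have := hH.maxLength_le_mul (p := 1) (q := n) hn
        simp only [Nat.cast_one, one_mul] at this
        exact sub_nonneg.2 this
      have m1 : (n : ℝ) ^ 2 * h ^ 2 ≤ 1 := by
        rw [← mul_pow]
        refine pow_le_one₀ (by positivity) ?_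
        have := (le_div_iff₀ hn0).1 b2
        linarith
      have m2 : 1 ≤ ((n : ℝ) + 1) ^ 2 * h ^ 2 := by
        rw [← mul_pow]
        refine one_le_pow₀ ?_
        have := (div_le_iff₀ (by positivity)).1 b1
        linarith
      have p1 := hPn (n + 1) (by omega)
      have p2 := hPn n (by omega)
      constructor
      · rw [le_div_iff₀ (by positivity)]
        have := mul_le_mul_of_nonneg_right m1 (mul_nonneg hh.le p1)
        nlinarith
      · rw [div_le_iff₀ (by positivity)]
        have := mul_le_mul_of_nonneg_right m2 (mul_nonneg hh.le p2)
        nlinarith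
    exact tendsto_of_tendsto_of_tendsto_of_le_of_le' (low.comp hfl) (up.comp hfl)
      (hev.mono fun _ h => h.1) (hev.mono fun _ h => h.2)
  rw [HasTaylorCoeffs, isLittleO_iff_tendsto']
  · have := hmain.sub_const c
    rw [sub_self] at this
    refine this.congr' ?_
    filter_upwards [self_mem_nhdsWithin] with h hh
    have hh : h ≠ 0 := (mem_Ioi.1 hh).ne'
    simp only [Finset.sum_range_succ, Finset.range_zero, Finset.sum_empty]
    simp [Nat.factorial]
    field_simp
    ring
  · filter_upwards [self_mem_nhdsWithin] with h hh h0
    exact absurd h0 (pow_ne_zero 3 (mem_Ioi.1 hh).ne')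

end

end Billiard

theorem corollary2 (Ω : Set Billiard.Plane) (ℓ : ℝ) (ξ : ℝ → Billiard.Plane)
    (hΩ : Billiard.IsStrictlyConvexDomain Ω) (hξ : Billiard.IsArcLengthBoundary Ω ℓ ξ) :
    -- the limits that define `β` at irrational rotation numbers exist
    (∀ w : ℝ, Irrational w → w ∈ Ioo (0 : ℝ) (1 / 2) →
      Tendsto (Billiard.betaRat ξ ℓ) (comap (fun r : ℚ => (r : ℝ)) (𝓝 w))
        (𝓝 (Billiard.beta ξ ℓ w))) ∧
    -- `β` has a third order Taylor expansion at `0⁺`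
    (∃ b : ℕ → ℝ, Billiard.HasTaylorCoeffs (Billiard.beta ξ ℓ) 3 b) ∧
    -- it is odd, and its coefficients satisfy the inequality, with equality only for discs
    (∀ b : ℕ → ℝ, Billiard.HasTaylorCoeffs (Billiard.beta ξ ℓ) 3 b →
      b 0 = 0 ∧ b 2 = 0 ∧
      b 3 + Real.pi ^ 2 * b 1 ≤ 0 ∧
      (b 3 + Real.pi ^ 2 * b 1 = 0 ↔ Billiard.IsDisc Ω)) := by
  obtain ⟨σ, hc⟩ := Billiard.exists_isConvexCurve hΩ hξ
  have hH := hc.isChordLength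
  have hT := Billiard.hasTaylorCoeffs_beta hH
    (Billiard.tendsto_sub_maxLength hξ.smooth hξ.unitSpeed hξ.periodic hH)
  obtain ⟨hle, heq⟩ := hc.affine_isoperimetric
  refine ⟨fun w hi hw => Billiard.tendsto_beta hH hi hw, ⟨_, hT⟩, fun b hb => ?_⟩
  have hu := hb.unique hT
  have h0 := hu 0 (by norm_num)
  have h1 := hu 1 (by norm_num)
  have h2 := hu 2 (by norm_num)
  have h3 := hu 3 (by norm_num)
  norm_num at h0 h1 h2 h3
  -- Here `b 1 = -ℓ` and `b 3 = 6 * (L ^ 3 / 24)`, so the claim is `L ^ 3 ≤ 4 π ^ 2 ℓ` divided by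
  -- `4`.
  rw [h1, h3, Billiard.isDisc_iff hΩ hξ hc, ← heq]
  refine ⟨h0, h2, by linarith, fun h => by linarith, fun h => by linarith⟩
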